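/- Let $M$ be a rational homology sphere, i.e. a smooth, closed, oriented $3$-manifold with the rational homology of $S^3$. Let $\infty\in M$, and fix an orientation-preserving diffeomorphism from a neighbourhood $V_\infty$ of $\infty$ in $M$ to the neighbourhood $S^3\setminus B(1)$ of $\infty$ in $S^3=\mathbb R^3\cup\{\infty\}$ that maps $\infty$ to $\infty$, where $B(1)$ is the open unit ball of $\mathbb R^3$. Put $\check M=M\setminus\{\infty\}$ and $\check V_\infty=V_\infty\setminus\{\infty\}$, and identify $\check V_\infty$ with $\mathbb R^3\setminus B(1)$. Let $g$ be a smooth Riemannian metric on $\check M$ that is the Euclidean metric on $\check V_\infty$, and let $X$ be a smooth $g$-unit vector field on $\check M$ that is equal to $(0,0,1)$ on $\check V_\infty$ (a representative of a combing). Let $UX^\perp\to\check M$ be the bundle of unit tangent vectors orthogonal to $X$; it is a principal $S^1$-bundle, where $S^1$ acts by rotations of axis $X$. Let $e(UX^\perp)\in H^2(\check M;\mathbb Z)$ be its Euler class, i.e. the obstruction to the existence of a section of $UX^\perp$. For an integer $p\ge 1$ let $\mathbb U_p\subset S^1$ be the group of $p$-th roots of unity, and let $f_p\colon UX^\perp\to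 UX^\perp_p=UX^\perp/\mathbb U_p$ be the quotient map. A $p$-multisection of $UX^\perp$ is a smooth section of $UX^\perp_p\to\check M$ that coincides on $\check V_\infty$ with the image under $f_p$ of the constant section $(1,0,0)$. Let $p\ge 1$ be a multiple of the order of $e(UX^\perp)$. Then: 1. there exists a $p$-multisection of $UX^\perp$; 2. for any two $p$-multisections $\nu,\nu'$ of $UX^\perp$ there exists a smooth homotopy $H\colon[0,1]\times\check M\to UX^\perp_p$ from $\nu$ to $\nu'$ such that $H(t,\cdot)$ is a $p$-multisection of $UX^\perp$ for every $t\in[0,1]$. -/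

import Mathlib

open scoped Manifold ContDiff Topology
open Bundle

universe u

noncomputable section

/-- `ℝ³` with its Euclidean structure. -/
abbrev E3 : Type := EuclideanSpace ℝ (Fin 3)

/-- The `i`-th vector of the canonical basis of `ℝ³`. -/
def stdVec (i : Fin 3) : E3 := EuclideanSpace.single i (1 : ℝ)

/-! ### Singular cohomology with integer coefficients -/

namespace SingularCohomology

/-- Singular `n`-simplices of `B`. -/
abbrev Simplex (B : Type u) [TopologicalSpace B] (n : ℕ) : Type u :=
  C(stdSimplex ℝ (Fin (n + 1)), B)

/-- The inclusion of the `i`-th face (the one opposite to the `i`-th vertex). -/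
def faceMap (n : ℕ) (i : Fin (n + 2)) :
    C(stdSimplex ℝ (Fin (n + 1)), stdSimplex ℝ (Fin (n + 2))) :=
  ⟨stdSimplex.map i.succAbove, stdSimplex.continuous_map i.succAbove⟩

/-- The `i`-th face of a singular simplex. -/
def face {B : Type u} [TopologicalSpace B] {n : ℕ} (i : Fin (n + 2)) (σ : Simplex B (n + 1)) :
    Simplex B n :=
  σ.comp (faceMap n i)

/-- Integral singular cochains, that is homomorphisms from the free abelian group on the singular
`n`-simplices to `ℤ`. -/
abbrev Cochain (B : Type u) [TopologicalSpace B] (n : ℕ) : Type u := Simplex B n → ℤ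

/-- The coboundary `(δ c)(σ) = c (∂ σ)`. -/
def coboundary (B : Type u) [TopologicalSpace B] (n : ℕ) : Cochain B n →+ Cochain B (n + 1) where
  toFun c σ := ∑ i : Fin (n + 2), (-1) ^ (i : ℕ) * c (face i σ)
  map_zero' := by
    funext σ
    simp
  map_add' c d := by
    funext σ
    simp [mul_add, Finset.sum_add_distrib]

/-- The cocycles of degree `n`. -/
def cocycles (B : Type u) [TopologicalSpace B] (n : ℕ) : AddSubgroup (Cochain B n) :=
  (coboundary B n).ker

/-- The coboundaries of degree `n`. -/
def coboundaries (B : Type u) [TopologicalSpace B] : (n : ℕ) → AddSubgroup (Cochain B n)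
  | 0 => ⊥
  | n + 1 => (coboundary B n).range

end SingularCohomology

/-- The singular cohomology group `H^n(B; ℤ)`. -/
abbrev SingularCohomology (B : Type u) [TopologicalSpace B] (n : ℕ) : Type u :=
  SingularCohomology.cocycles B n ⧸
    (SingularCohomology.coboundaries B n).addSubgroupOf (SingularCohomology.cocycles B n)

/-! ### Rational homology spheres and orientations -/

/-- Singular homology with rational coefficients. -/
abbrev rationalHomology (M : Type u) [TopologicalSpace M] (n : ℕ) : ModuleCat.{u} ℚ :=
  ((AlgebraicTopology.singularHomologyFunctor (ModuleCat.{u} ℚ) n).obj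
    (ModuleCat.of ℚ (ULift.{u} ℚ))).obj (TopCat.of M)

/-- `M` has the rational homology of the 3-sphere: `ℚ` in degrees `0` and `3`, zero in the other
degrees. -/
structure HasRationalHomologyOfSphere3 (M : Type u) [TopologicalSpace M] : Prop where
  zero_three : ∀ n, n = 0 ∨ n = 3 →
    Nonempty (CategoryTheory.Iso (rationalHomology M n) (ModuleCat.of ℚ (ULift.{u} ℚ)))
  other : ∀ n, n ≠ 0 → n ≠ 3 → CategoryTheory.Limits.IsZero (rationalHomology M n)

section Setting

variable (M : Type u) [TopologicalSpace M] [ChartedSpace E3 M] [IsManifold (𝓡 3) ∞ M]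

/-- An orientation of a smooth 3-manifold: an orientation of each tangent space which, locally, is
the orientation given by a continuous frame. -/
structure ManifoldOrientation where
  orient : ∀ m : M, Orientation ℝ (TangentSpace (𝓡 3) m) (Fin 3)
  locally_frame : ∀ m₀ : M, ∃ U ∈ 𝓝 m₀, ∃ s : Fin 3 → ∀ m : M, TangentSpace (𝓡 3) m,
    (∀ i, ContinuousOn (fun m => (⟨m, s i m⟩ : TangentBundle (𝓡 3) M)) U) ∧
    ∀ m ∈ U, ∃ b : Module.Basis (Fin 3) ℝ (TangentSpace (𝓡 3) m),
      (∀ i, b i = s i m) ∧ b.orientation = orient m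

variable {M}

/-- The open submanifold `M ∖ {pt}`. -/
abbrev punctured [T2Space M] (pt : M) : TopologicalSpace.Opens M :=
  ⟨{pt}ᶜ, isOpen_compl_singleton⟩

/-- `(v₀, v₁, v₂)` is a basis of the tangent space to `M ∖ {pt}` at `m` that is positive for the
orientation of `M`. -/
def IsPositiveFrame [T2Space M] (o : ManifoldOrientation M) {pt : M} (m : punctured pt)
    (v : Fin 3 → TangentSpace (𝓡 3) m) : Prop :=
  ∃ b : Module.Basis (Fin 3) ℝ (TangentSpace (𝓡 3) (m : M)),
    (∀ i, b i = mfderiv (𝓡 3) (𝓡 3) (Subtype.val : punctured pt → M) m (v i)) ∧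
    b.orientation = o.orient m

variable [T2Space M]

/-- A point `∞` of `M` together with an orientation-preserving diffeomorphism from a neighbourhood
`V` of `∞` to `S³ ∖ B(1)`, where `S³ = ℝ³ ∪ {∞}` and `B(1)` is the open unit ball.

The diffeomorphism is recorded in the chart `y ↦ y / ‖y‖²` of `S³` at infinity, which takes
`S³ ∖ B(1)` to the closed unit ball and `∞` to `0`. As usual for subsets of manifolds, it is smooth
in the sense that it is the restriction of a diffeomorphism between open sets, here a chart of `M`
whose target contains the closed unit ball. What this chart does outside of `V` is never used. -/
structure ChartAtInfinity (o : ManifoldOrientation M) where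
  chart : OpenPartialHomeomorph M E3
  mem_maximalAtlas : chart ∈ IsManifold.maximalAtlas (𝓡 3) ∞ M
  closedBall_subset : Metric.closedBall (0 : E3) 1 ⊆ chart.target
  /-- The diffeomorphism preserves orientations on `V ∖ {∞}`: a tangent frame which is sent to
  the canonical basis of `ℝ³` is positive. -/
  orientation_preserving : ∀ m : punctured (chart.symm 0),
    (m : M) ∈ chart.symm '' Metric.closedBall (0 : E3) 1 →
    ∀ v : Fin 3 → TangentSpace (𝓡 3) m,
      (∀ i, mfderiv (𝓡 3) (𝓡 3)
        (fun n : punctured (chart.symm 0) => EuclideanGeometry.inversion (0 : E3) 1 (chart n))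
        m (v i) = stdVec i) →
      IsPositiveFrame o m v

namespace ChartAtInfinity

variable {o : ManifoldOrientation M} (φ : ChartAtInfinity o)

/-- The point `∞`. -/
def infty : M := φ.chart.symm 0

/-- The manifold `M ∖ {∞}`. -/
abbrev Mcheck : TopologicalSpace.Opens M := punctured φ.infty

/-- `V ∖ {∞}`, as a subset of `M ∖ {∞}`. -/
def Vcheck : Set φ.Mcheck := {m | (m : M) ∈ φ.chart.symm '' Metric.closedBall (0 : E3) 1}

/-- The diffeomorphism from `V ∖ {∞}` to `ℝ³ ∖ B(1)` (meaningful on `V ∖ {∞}` only). -/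
def coord (m : φ.Mcheck) : E3 := EuclideanGeometry.inversion (0 : E3) 1 (φ.chart m)

/-- The differential of `coord`, which identifies the tangent spaces over `V ∖ {∞}` with `ℝ³`. -/
def dcoord (m : φ.Mcheck) (v : TangentSpace (𝓡 3) m) : E3 :=
  mfderiv (𝓡 3) (𝓡 3) φ.coord m v

/-- Smooth Riemannian metrics on `M ∖ {∞}`. -/
abbrev RiemMetric : Type u :=
  ContMDiffRiemannianMetric (𝓡 3) ∞ E3 (fun m : φ.Mcheck => TangentSpace (𝓡 3) m)

/-- The metric coincides with the Euclidean one on `V ∖ {∞}`. -/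
def IsStandardMetric (g : φ.RiemMetric) : Prop :=
  ∀ m ∈ φ.Vcheck, ∀ v w : TangentSpace (𝓡 3) m,
    g.inner m v w = inner ℝ (φ.dcoord m v) (φ.dcoord m w)

/-- `X` is a smooth section of the unit tangent bundle of `M ∖ {∞}` that coincides with `(0,0,1)`
on `V ∖ {∞}`, i.e. `X` represents a combing. -/
structure IsCombing (g : φ.RiemMetric) (X : ∀ m : φ.Mcheck, TangentSpace (𝓡 3) m) : Prop where
  smooth : ContMDiff (𝓡 3) (𝓡 3).tangent ∞
    (fun m => (⟨m, X m⟩ : TangentBundle (𝓡 3) φ.Mcheck))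
  unit : ∀ m, g.inner m (X m) (X m) = 1
  standard : ∀ m ∈ φ.Vcheck, φ.dcoord m (X m) = stdVec 2

variable (g : φ.RiemMetric) (X : ∀ m : φ.Mcheck, TangentSpace (𝓡 3) m)

/-! ### The circle bundle `UX^⊥` and its quotient by the `p`-th roots of unity -/

/-- The space `UX^⊥` of unit tangent vectors orthogonal to `X`. -/
abbrev UPerp : Type u :=
  {e : TangentBundle (𝓡 3) φ.Mcheck //
    g.inner e.proj e.snd e.snd = 1 ∧ g.inner e.proj e.snd (X e.proj) = 0}

namespace UPerp

variable {φ g X}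

/-- The bundle projection of `UX^⊥`. -/
def base (e : φ.UPerp g X) : φ.Mcheck := e.1.proj

/-- `e'` is the image of `e` under the rotation of axis `X` and angle `θ`, that is
`e' = cos θ e + sin θ w` where `(e, w, X)` is a positive orthonormal basis. This is the action of
`exp (iθ) ∈ S¹` on the principal bundle `UX^⊥`. -/
def Rotates (θ : ℝ) (e e' : φ.UPerp g X) : Prop :=
  ∃ w : TangentSpace (𝓡 3) e.1.proj,
    g.inner e.1.proj w w = 1 ∧ g.inner e.1.proj e.1.snd w = 0 ∧
    g.inner e.1.proj w (X e.1.proj) = 0 ∧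
    IsPositiveFrame o e.1.proj ![e.1.snd, w, X e.1.proj] ∧
    e'.1 = ⟨e.1.proj, Real.cos θ • e.1.snd + Real.sin θ • w⟩

theorem Rotates.base_eq {θ : ℝ} {e e' : φ.UPerp g X} (h : Rotates θ e e') :
    e.base = e'.base := by
  obtain ⟨w, -, -, -, -, h⟩ := h
  simp [base, h]

end UPerp

/-- The quotient `UX^⊥_p = UX^⊥ / 𝕌_p`, where `𝕌_p` is the group of `p`-th roots of unity. -/
def UPerpMod (p : ℕ) : Type u :=
  Quot fun e e' : φ.UPerp g X => ∃ k : ℕ, UPerp.Rotates (2 * Real.pi * k / p) e e'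

namespace UPerpMod

variable {φ g X} {p : ℕ}

/-- The quotient map `f_p : UX^⊥ → UX^⊥_p`. -/
def mk (e : φ.UPerp g X) : φ.UPerpMod g X p := Quot.mk _ e

/-- The bundle projection of `UX^⊥_p`. -/
def base (x : φ.UPerpMod g X p) : φ.Mcheck :=
  Quot.lift UPerp.base (fun _ _ ⟨_, h⟩ => h.base_eq) x

/-- Smooth maps to `UX^⊥_p`. Since `f_p` is a covering map and the smooth structure of the quotient
is the one that makes it a local diffeomorphism, a map to `UX^⊥_p` is smooth when it locally
lifts to a smooth map to `UX^⊥`, i.e. to a smooth map to the tangent bundle with values in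
`UX^⊥`. -/
def IsSmooth {E' H P : Type*} [NormedAddCommGroup E'] [NormedSpace ℝ E'] [TopologicalSpace H]
    (J : ModelWithCorners ℝ E' H) [TopologicalSpace P] [ChartedSpace H P]
    (f : P → φ.UPerpMod g X p) : Prop :=
  ∀ x₀ : P, ∃ U : Set P, IsOpen U ∧ x₀ ∈ U ∧ ∃ F : P → TangentBundle (𝓡 3) φ.Mcheck,
    ContMDiffOn J (𝓡 3).tangent ∞ F U ∧
    ∀ x ∈ U, ∃ e : φ.UPerp g X, e.1 = F x ∧ f x = mk e

end UPerpMod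

/-- A `p`-multisection of `UX^⊥`: a smooth section of `UX^⊥_p` that coincides on `V ∖ {∞}` with
the image of the constant section `(1,0,0)` of `UX^⊥`. -/
structure IsMultisection (p : ℕ) (ν : φ.Mcheck → φ.UPerpMod g X p) : Prop where
  base_eq : ∀ m, (ν m).base = m
  smooth : UPerpMod.IsSmooth (𝓡 3) ν
  standard : ∀ m ∈ φ.Vcheck, ∃ e : φ.UPerp g X,
    e.base = m ∧ φ.dcoord e.1.proj e.1.snd = stdVec 0 ∧ ν m = UPerpMod.mk e

/-- `H` is a smooth homotopy from `ν` to `ν'` through `p`-multisections. -/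
structure IsHomotopyOfMultisections (p : ℕ) (ν ν' : φ.Mcheck → φ.UPerpMod g X p)
    (H : unitInterval × φ.Mcheck → φ.UPerpMod g X p) : Prop where
  smooth : UPerpMod.IsSmooth ((𝓡∂ 1).prod (𝓡 3)) H
  source : ∀ m, H (0, m) = ν m
  target : ∀ m, H (1, m) = ν' m
  multisection : ∀ t, φ.IsMultisection g X p (fun m => H (t, m))

/-! ### The Euler class -/

open SingularCohomology in
/-- `c` is an obstruction cochain of the circle bundle `UX^⊥`: there are a lift `s₀` of the
singular 0-simplices (the points) of `M ∖ {∞}` to `UX^⊥` and a continuous lift `s₁` of the singular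
1-simplices, which agrees with `s₀` at the ends, such that the value of `c` at each singular
2-simplex `σ` is the degree of the section of `σ^* UX^⊥` over the boundary of the 2-simplex that
`s₁` defines. The degree is computed with respect to a section `τ` of `σ^* UX^⊥` over the
2-simplex: on the `i`-th face, the section given by `s₁` is the rotation of `τ` of angle `2π θᵢ`
where `θᵢ` is a continuous real function, and the degree is the total variation of these functions
along the oriented boundary of the 2-simplex. -/
def IsObstructionCochain (c : Cochain φ.Mcheck 2) : Prop :=
  ∃ (s₀ : φ.Mcheck → φ.UPerp g X) (s₁ : Simplex φ.Mcheck 1 → Simplex (φ.UPerp g X) 1),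
    (∀ m, (s₀ m).base = m) ∧
    (∀ γ t, (s₁ γ t).base = γ t) ∧
    (∀ γ (i : Fin 2), s₁ γ (stdSimplex.vertex i) = s₀ (γ (stdSimplex.vertex i))) ∧
    ∀ σ : Simplex φ.Mcheck 2,
      ∃ (τ : Simplex (φ.UPerp g X) 2) (θ : Fin 3 → C(stdSimplex ℝ (Fin 2), ℝ)),
        (∀ x, (τ x).base = σ x) ∧
        (∀ i t, UPerp.Rotates (2 * Real.pi * θ i t) (τ (faceMap 1 i t)) (s₁ (face i σ) t)) ∧
        (c σ : ℝ) = ∑ i : Fin 3,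
          (-1) ^ (i : ℕ) * (θ i (stdSimplex.vertex 1) - θ i (stdSimplex.vertex 0))

/-- `e` is the Euler class of `UX^⊥` in `H²(M ∖ {∞}; ℤ)`, that is the obstruction to the existence
of a section of `UX^⊥`: the class of any obstruction cochain. (Obstruction cochains exist, are
cocycles, and all have the same class.) -/
def IsEulerClass (e : SingularCohomology φ.Mcheck 2) : Prop :=
  ∃ c : SingularCohomology.cocycles φ.Mcheck 2,
    φ.IsObstructionCochain g X (c : SingularCohomology.Cochain φ.Mcheck 2) ∧
    e = QuotientAddGroup.mk c

end ChartAtInfinity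

end Setting

end

/-!
A choice of a positive orthonormal frame `(e, w, X)` at each point, with no regularity, identifies
the fibres of `UX^⊥` with the unit circle of `ℂ`, and those of `UX^⊥_p` with the unit circle by the
`p`-th power (`RefFrame.coord`, `RefFrame.coordMod`). A smooth local section of `UX^⊥` is then a
function `σ` to the circle, called a gauge. Quotients of gauges are smooth, and a section of `UX^⊥_p`
is smooth if and only if its coordinate is locally the `p`-th power of a gauge. The section `(1,0,0)`
near infinity extends to a gauge over a slightly larger punctured ball
(`RefFrame.exists_standard_gauge`).

Existence. Let `s₀`, `s₁` be the lifts of points and paths that define the obstruction cochain `c`.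
As `p` kills the class of `c`, there is an integral cochain `b` with `δ b = p c`. In a gauge `σ` over
`U`, let `A(γ)` be the variation of `s₁ γ` with respect to `σ`, in turns. Then `p A - b` is a
cocycle on `U` (`ObstructionPrimitive.sum_period_face`), and if `U` is contractible it is the
coboundary of a function `h` such that `exp (2πi h) = (s₀ / σ)^p`: a potential
(`ObstructionPrimitive.exists_isPotential`). Potentials in two gauges differ by a smooth function,
since the variation of the difference along a path is that of the `p`-th power of the quotient of the
gauges (`ObstructionPrimitive.IsPotential.contMDiffOn_sub`). Hence local potentials can be glued by a
partition of unity to a function `K` which differs from each of them by a smooth function, and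
`s₀^p exp (-2πi K) = σ^p exp (2πi (h - K))` is the coordinate of a smooth section of `UX^⊥_p`. For
this section to be `(1,0,0)` on `V ∖ {∞}`, the potentials have to agree there with one potential of
the standard gauge. The latter exists because the punctured ball is the union of two slit balls,
which are contractible, with a connected intersection
(`ObstructionPrimitive.exists_isPotential_ballCheck`).

Homotopies. The quotient of the coordinates of two multisections is a smooth circle-valued function
on `M ∖ {∞}` which is `1` on `V ∖ {∞}`, so that it extends to `M`. Its variation along paths vanishes
on boundaries of singular `2`-simplices; as `H₁(M; ℚ) = 0`, it is the coboundary of a real function,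
which gives a smooth logarithm that vanishes on `V ∖ {∞}` (`exists_smooth_turn_eq`). Multiplying the
logarithm by `t ∈ [0,1]` yields the homotopy.
-/

noncomputable section

/-! ### Cocycles on a space without rational first homology -/

namespace SingularCohomology

open CategoryTheory Limits Simplicial

section
variable (S : SSet.{u})

/-- The linear map from rational simplicial chains to `ℝ` that extends a function on simplices. -/
def chainHom {n : ℕ} (B : S _⦋n⦌ → ℝ) :
    (S.chainComplex (ModuleCat.of ℚ (ULift.{u} ℚ))).X n ⟶ ModuleCat.of ℚ (ULift.{u} ℝ) :=
  Cofan.IsColimit.desc (SSet.isColimitChainComplexXCofan _ _ n) fun x =>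
    ModuleCat.ofHom (ULift.moduleEquiv.symm.toLinearMap ∘ₗ
      (LinearMap.toSpanSingleton ℚ ℝ (B x)) ∘ₗ ULift.moduleEquiv.toLinearMap)

theorem ι_chainHom {n : ℕ} (B : S _⦋n⦌ → ℝ) (x : S _⦋n⦌) :
    S.ιChainComplex x ≫ chainHom S B =
      ModuleCat.ofHom (ULift.moduleEquiv.symm.toLinearMap ∘ₗ
      (LinearMap.toSpanSingleton ℚ ℝ (B x)) ∘ₗ ULift.moduleEquiv.toLinearMap) :=
  Cofan.IsColimit.fac (SSet.isColimitChainComplexXCofan _ _ n) _ x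

theorem injective_ulift_real : Injective (ModuleCat.of ℚ (ULift.{u} ℝ)) :=
  have : Module.Injective ℚ (ULift.{u} ℝ) := Module.injective_of_isSemisimpleRing ℚ _
  Module.injective_object_of_injective_module ℚ _

/-- If `H₁(S; ℚ) = 0`, a function on `1`-simplices that vanishes on boundaries vanishes on cycles.
It thus factors through the boundary map and, `ℝ` being injective over `ℚ`, it is the coboundary of
a function on the vertices. -/
theorem exists_eq_sub_of_isZero_homology
    (hS : IsZero (S.homology (ModuleCat.of ℚ (ULift.{u} ℚ)) 1)) (B : S _⦋1⦌ → ℝ)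
    (hB : ∀ x : S _⦋2⦌, B (S.δ 0 x) - B (S.δ 1 x) + B (S.δ 2 x) = 0) :
    ∃ h : S _⦋0⦌ → ℝ, ∀ x : S _⦋1⦌, B x = h (S.δ 0 x) - h (S.δ 1 x) := by
  set K := S.chainComplex (ModuleCat.of ℚ (ULift.{u} ℚ)) with hK
  have hd : K.d 2 1 ≫ chainHom S B = 0 := by
    apply SSet.chainComplex_hom_ext
    intro x
    rw [SSet.ιChainComplex_d_assoc, Preadditive.sum_comp]
    simp only [Preadditive.zsmul_comp, ι_chainHom, comp_zero]
    ext q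
    have h1 := hB x
    simp [Fin.sum_univ_succ, Rat.smul_def]
    linear_combination (q.down : ℝ) * h1
  have hex : (K.sc' 2 1 0).Exact := by
    rw [← K.exactAt_iff' 2 1 0 (by simp) (by simp), K.exactAt_iff_isZero_homology]
    exact hS
  have := injective_ulift_real.{u}
  let D : K.X 0 ⟶ ModuleCat.of ℚ (ULift.{u} ℝ) := hex.descToInjective (chainHom S B) hd
  have hD : K.d 1 0 ≫ D = chainHom S B := hex.comp_descToInjective (chainHom S B) hd
  refine ⟨fun x => ((S.ιChainComplex x ≫ D).hom (ULift.up 1)).down, fun x => ?_⟩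
  have h2 : (S.ιChainComplex x ≫ K.d 1 0) ≫ D = S.ιChainComplex x ≫ chainHom S B := by
    rw [Category.assoc, hD]
  rw [SSet.ιChainComplex_d, ι_chainHom, Preadditive.sum_comp] at h2
  have h3 := congrArg (fun f => (f.hom (ULift.up 1)).down) h2
  simp [Fin.sum_univ_succ] at h3
  simp
  linear_combination -h3
end

variable {M : Type u} [TopologicalSpace M]

theorem faceMap_zero (i : Fin 2) (t : stdSimplex ℝ (Fin 1)) :
    faceMap 0 i t = stdSimplex.vertex (i.succAbove 0) := by
  rw [Subsingleton.elim t (stdSimplex.vertex 0)]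
  exact stdSimplex.map_vertex _ _

/-- The case of the singular set of `M`, in terms of continuous maps from the standard simplices. -/
theorem exists_potential_of_isZero_rationalHomology
    (hM : IsZero (rationalHomology M 1)) (B : Simplex M 1 → ℝ)
    (hB : ∀ σ : Simplex M 2, B (face 0 σ) - B (face 1 σ) + B (face 2 σ) = 0) :
    ∃ h : M → ℝ, ∀ γ : Simplex M 1,
      B γ = h (γ (stdSimplex.vertex 1)) - h (γ (stdSimplex.vertex 0)) := by
  obtain ⟨h, hh⟩ := exists_eq_sub_of_isZero_homology (TopCat.toSSet.obj (TopCat.of M)) hM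
    (fun x => B (TopCat.toSSetObjEquiv (TopCat.of M) (.op ⦋1⦌) x))
    (fun x => hB (TopCat.toSSetObjEquiv (TopCat.of M) (.op ⦋2⦌) x))
  refine ⟨fun x => h ((TopCat.toSSetObjEquiv (TopCat.of M) (.op ⦋0⦌)).symm (.const _ x)),
    fun γ => ?_⟩
  have h1 := hh ((TopCat.toSSetObjEquiv (TopCat.of M) (.op ⦋1⦌)).symm γ)
  simp only [Equiv.apply_symm_apply] at h1
  rw [h1]
  congr 2
  · rw [Equiv.eq_symm_apply]
    ext t
    exact congrArg γ (faceMap_zero 0 t)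
  · rw [Equiv.eq_symm_apply]
    ext t
    exact congrArg γ (faceMap_zero 1 t)

end SingularCohomology

/-! ### Lifts of circle-valued functions -/

/-- The unit complex number of angle `θ`, measured in turns. -/
def turn (θ : ℝ) : ℂ := Complex.exp ((2 * Real.pi * θ : ℝ) * Complex.I)

theorem turn_add (a b : ℝ) : turn (a + b) = turn a * turn b := by
  simp only [turn, ← Complex.exp_add]
  congr 1
  push_cast
  ring

@[simp]
theorem turn_zero : turn 0 = 1 := by simp [turn]

@[simp]
theorem norm_turn (a : ℝ) : ‖turn a‖ = 1 := Complex.norm_exp_ofReal_mul_I _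

theorem turn_ne_zero (a : ℝ) : turn a ≠ 0 := Complex.exp_ne_zero _

theorem turn_neg (a : ℝ) : turn (-a) = (turn a)⁻¹ := by
  refine eq_inv_of_mul_eq_one_left ?_
  rw [← turn_add]
  simp

theorem turn_sub (a b : ℝ) : turn (a - b) = turn a / turn b := by
  rw [sub_eq_add_neg, turn_add, turn_neg, div_eq_mul_inv]

theorem turn_natCast_mul (n : ℕ) (a : ℝ) : turn (n * a) = turn a ^ n := by
  rw [turn, turn, ← Complex.exp_nat_mul]
  congr 1
  push_cast
  ring

theorem turn_eq_one_iff {a : ℝ} : turn a = 1 ↔ ∃ n : ℤ, a = n := by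
  rw [turn, Complex.exp_eq_one_iff]
  have h2 : (2 * Real.pi * Complex.I : ℂ) ≠ 0 := Complex.two_pi_I_ne_zero
  refine exists_congr fun n => ⟨fun h => ?_, fun h => ?_⟩
  · have : ((a : ℂ) - n) * (2 * Real.pi * Complex.I) = 0 := by
      push_cast at h
      linear_combination h
    have h3 := (mul_eq_zero.1 this).resolve_right h2
    exact_mod_cast sub_eq_zero.1 h3
  · subst h
    push_cast
    ring

@[simp]
theorem turn_intCast (n : ℤ) : turn n = 1 := turn_eq_one_iff.2 ⟨n, rfl⟩

theorem exists_turn_eq {z : ℂ} (hz : ‖z‖ = 1) : ∃ a : ℝ, turn a = z := by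
  refine ⟨z.arg / (2 * Real.pi), ?_⟩
  have h := Complex.norm_mul_exp_arg_mul_I z
  rw [hz, Complex.ofReal_one, one_mul] at h
  rw [turn, mul_div_cancel₀ _ Real.two_pi_pos.ne', h]

theorem contDiff_turn : ContDiff ℝ ∞ turn :=
  Complex.contDiff_exp.comp
    ((Complex.ofRealCLM.contDiff.comp (contDiff_const.mul contDiff_id)).mul contDiff_const)

theorem continuous_turn : Continuous turn := contDiff_turn.continuous

theorem turn_div_two_pi (a : ℝ) : turn (a / (2 * Real.pi)) = Complex.exp (a * Complex.I) := by
  rw [turn, mul_div_cancel₀ _ Real.two_pi_pos.ne']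

/-- Two lifts of the same function to `ℝ` on a connected set differ by a constant. -/
theorem sub_eq_sub_of_turn_eq {X : Type*} [TopologicalSpace X] {s : Set X} (hs : IsPreconnected s)
    {θ θ' : X → ℝ} (hθ : ContinuousOn θ s) (hθ' : ContinuousOn θ' s)
    (h : ∀ x ∈ s, turn (θ x) = turn (θ' x)) {x y : X} (hx : x ∈ s) (hy : y ∈ s) :
    θ x - θ' x = θ y - θ' y := by
  have hint : ∀ x ∈ s, ∃ n : ℤ, θ x - θ' x = n := fun x hx => by
    rw [← turn_eq_one_iff, turn_sub, h x hx, div_self (turn_ne_zero _)]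
  have hmaps : Set.MapsTo (fun x => θ x - θ' x) s (Set.range ((↑) : ℤ → ℝ)) := fun x hx => by
    obtain ⟨n, hn⟩ := hint x hx
    exact ⟨n, hn.symm⟩
  exact hs.constant_of_mapsTo Int.isClosedEmbedding_coe_real.isEmbedding.isDiscrete_range
    (hθ.sub hθ') hmaps hx hy

/-- Circle-valued functions on a contractible space lift to `ℝ`. -/
theorem exists_turn_lift_of_contraction {K : Type*} [TopologicalSpace K] (x₀ : K)
    (C : C(unitInterval × K, K)) (hC₀ : ∀ x, C (0, x) = x₀) (hC₁ : ∀ x, C (1, x) = x)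
    {f : K → ℂ} (hf : Continuous f) (hf1 : ∀ x, ‖f x‖ = 1) :
    ∃ θ : C(K, ℝ), ∀ x, turn (θ x) = f x := by
  obtain ⟨a, ha⟩ := exists_turn_eq (hf1 x₀)
  let F : C(unitInterval × K, Circle) :=
    ⟨fun q => ⟨f (C q), by simp [Submonoid.unitSphere, hf1]⟩, by fun_prop⟩
  have h0 : ∀ x, F (0, x) = Circle.exp ((ContinuousMap.const K (2 * Real.pi * a)) x) := fun x => by
    ext
    change f (C (0, x)) = _
    rw [hC₀, ← ha, turn, Circle.coe_exp]
    rfl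
  let G := Circle.isCoveringMap_exp.liftHomotopy F (.const K (2 * Real.pi * a)) h0
  have hG : ∀ q, Circle.exp (G q) = F q := fun q =>
    congrFun (Circle.isCoveringMap_exp.liftHomotopy_lifts F _ h0) q
  refine ⟨⟨fun x => G (1, x) / (2 * Real.pi), by fun_prop⟩, fun x => ?_⟩
  have h1 := congrArg (fun z : Circle => (z : ℂ)) (hG (1, x))
  simp only [Circle.coe_exp] at h1
  change turn (G (1, x) / (2 * Real.pi)) = _
  rw [turn_div_two_pi, h1]
  change f (C (1, x)) = _
  rw [hC₁]

/-- Circle-valued functions on a simplex lift to `ℝ`. -/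
theorem exists_turn_lift_stdSimplex {n : ℕ} {f : stdSimplex ℝ (Fin (n + 1)) → ℂ}
    (hf : Continuous f) (hf1 : ∀ x, ‖f x‖ = 1) :
    ∃ θ : C(stdSimplex ℝ (Fin (n + 1)), ℝ), ∀ x, turn (θ x) = f x := by
  let x₀ : stdSimplex ℝ (Fin (n + 1)) := stdSimplex.vertex 0
  refine exists_turn_lift_of_contraction x₀
    ⟨fun q => ⟨(1 - q.1 : ℝ) • x₀.1 + (q.1 : ℝ) • q.2.1,
      convex_stdSimplex ℝ _ x₀.2 q.2.2 (by linarith [q.1.2.2]) q.1.2.1 (by ring)⟩, ?_⟩ ?_ ?_ hf hf1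
  · refine Continuous.subtype_mk ?_ _
    fun_prop
  · intro x
    ext i
    simp
  · intro x
    ext i
    simp

open SingularCohomology

/-- The total variation, in turns, of a circle-valued function on the `1`-simplex; zero for a
function that has no continuous lift to `ℝ`. -/
def variation (f : stdSimplex ℝ (Fin 2) → ℂ) : ℝ :=
  open Classical in
  if h : ∃ θ : C(stdSimplex ℝ (Fin 2), ℝ), ∀ t, turn (θ t) = f t then
    h.choose (stdSimplex.vertex 1) - h.choose (stdSimplex.vertex 0) else 0

theorem variation_eq_of_lift {f : stdSimplex ℝ (Fin 2) → ℂ} {θ : stdSimplex ℝ (Fin 2) → ℝ}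
    (hθ : Continuous θ) (h : ∀ t, turn (θ t) = f t) :
    variation f = θ (stdSimplex.vertex 1) - θ (stdSimplex.vertex 0) := by
  have hex : ∃ θ : C(stdSimplex ℝ (Fin 2), ℝ), ∀ t, turn (θ t) = f t := ⟨⟨θ, hθ⟩, h⟩
  rw [variation, dif_pos hex]
  have := sub_eq_sub_of_turn_eq isPreconnected_univ hex.choose.continuous.continuousOn
    hθ.continuousOn (fun x _ => (hex.choose_spec x).trans (h x).symm)
    (Set.mem_univ (stdSimplex.vertex 1)) (Set.mem_univ (stdSimplex.vertex 0))
  linarith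

theorem variation_mul {f g : stdSimplex ℝ (Fin 2) → ℂ} (hf : Continuous f) (hf1 : ∀ x, ‖f x‖ = 1)
    (hg : Continuous g) (hg1 : ∀ x, ‖g x‖ = 1) :
    variation (fun t => f t * g t) = variation f + variation g := by
  obtain ⟨θ, hθ⟩ := exists_turn_lift_stdSimplex hf hf1
  obtain ⟨η, hη⟩ := exists_turn_lift_stdSimplex hg hg1
  rw [variation_eq_of_lift θ.continuous hθ, variation_eq_of_lift η.continuous hη,
    variation_eq_of_lift (θ := fun t => θ t + η t) (by fun_prop) fun t => by
      rw [turn_add, hθ, hη]]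
  ring

theorem variation_pow {f : stdSimplex ℝ (Fin 2) → ℂ} (hf : Continuous f) (hf1 : ∀ x, ‖f x‖ = 1)
    (n : ℕ) : variation (fun t => f t ^ n) = n * variation f := by
  obtain ⟨θ, hθ⟩ := exists_turn_lift_stdSimplex hf hf1
  rw [variation_eq_of_lift θ.continuous hθ,
    variation_eq_of_lift (θ := fun t => n * θ t) (by fun_prop)
      fun t => by rw [turn_natCast_mul, hθ]]
  ring

theorem variation_const {f : stdSimplex ℝ (Fin 2) → ℂ} {z : ℂ} (hz : ‖z‖ = 1)
    (hf : ∀ t, f t = z) : variation f = 0 := by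
  obtain ⟨a, ha⟩ := exists_turn_eq hz
  rw [variation_eq_of_lift (θ := fun _ => a) continuous_const fun t => by rw [ha, hf], sub_self]

theorem turn_variation {f : stdSimplex ℝ (Fin 2) → ℂ} (hf : Continuous f)
    (hf1 : ∀ x, ‖f x‖ = 1) :
    turn (variation f) = f (stdSimplex.vertex 1) / f (stdSimplex.vertex 0) := by
  obtain ⟨θ, hθ⟩ := exists_turn_lift_stdSimplex hf hf1
  rw [variation_eq_of_lift θ.continuous hθ, turn_sub, hθ, hθ]

theorem faceMap_vertex (n : ℕ) (i : Fin (n + 2)) (j : Fin (n + 1)) :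
    faceMap n i (stdSimplex.vertex j) = stdSimplex.vertex (i.succAbove j) :=
  stdSimplex.map_vertex _ _

/-- The alternating sum of the variations of a real function along the faces of a `2`-simplex
vanishes. -/
theorem sum_faceMap_sub (θ : stdSimplex ℝ (Fin 3) → ℝ) :
    ∑ i : Fin 3, (-1 : ℝ) ^ (i : ℕ) * (θ (faceMap 1 i (stdSimplex.vertex 1)) -
      θ (faceMap 1 i (stdSimplex.vertex 0))) = 0 := by
  simp only [faceMap_vertex, Fin.sum_univ_three]
  have h1 : (0 : Fin 3).succAbove (1 : Fin 2) = 2 := rfl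
  have h2 : (0 : Fin 3).succAbove (0 : Fin 2) = 1 := rfl
  have h3 : (1 : Fin 3).succAbove (1 : Fin 2) = 2 := rfl
  have h4 : (1 : Fin 3).succAbove (0 : Fin 2) = 0 := rfl
  have h5 : (2 : Fin 3).succAbove (1 : Fin 2) = 1 := rfl
  have h6 : (2 : Fin 3).succAbove (0 : Fin 2) = 0 := rfl
  rw [h1, h2, h3, h4, h5, h6]
  norm_num

theorem sum_variation_faceMap {f : stdSimplex ℝ (Fin 3) → ℂ} (hf : Continuous f)
    (hf1 : ∀ x, ‖f x‖ = 1) :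
    ∑ i : Fin 3, (-1 : ℝ) ^ (i : ℕ) * variation (fun t => f (faceMap 1 i t)) = 0 := by
  obtain ⟨θ, hθ⟩ := exists_turn_lift_stdSimplex hf hf1
  rw [← sum_faceMap_sub θ]
  refine Finset.sum_congr rfl fun i _ => ?_
  rw [variation_eq_of_lift (θ := fun t => θ (faceMap 1 i t)) (by fun_prop) fun t => hθ _]

/-- A path, seen as a singular `1`-simplex. -/
def pathSimplex {X : Type u} [TopologicalSpace X] {x y : X} (γ : Path x y) : Simplex X 1 :=
  γ.toContinuousMap.comp ⟨stdSimplexHomeomorphUnitInterval, by fun_prop⟩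

@[simp]
theorem pathSimplex_vertex_zero {X : Type u} [TopologicalSpace X] {x y : X} (γ : Path x y) :
    pathSimplex γ (stdSimplex.vertex 0) = x := γ.source

@[simp]
theorem pathSimplex_vertex_one {X : Type u} [TopologicalSpace X] {x y : X} (γ : Path x y) :
    pathSimplex γ (stdSimplex.vertex 1) = y := γ.target

/-- A real function whose variation along paths is that of a smooth circle-valued function `f` is
smooth: it locally differs by a constant from a branch of the logarithm of `f`. -/
theorem contMDiffOn_of_variation {X : Type u} [TopologicalSpace X] [ChartedSpace E3 X]
    {U : Set X} (hU : IsOpen U) {f : X → ℂ} (hf : ContMDiffOn (𝓡 3) 𝓘(ℝ, ℂ) ∞ f U)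
    (hf1 : ∀ x ∈ U, ‖f x‖ = 1) {h : X → ℝ}
    (hh : ∀ γ : Simplex X 1, (∀ t, γ t ∈ U) →
      h (γ (stdSimplex.vertex 1)) - h (γ (stdSimplex.vertex 0)) = variation fun t => f (γ t)) :
    ContMDiffOn (𝓡 3) 𝓘(ℝ, ℝ) ∞ h U := by
  have : LocallyPathConnectedSpace X := ChartedSpace.locallyPathConnectedSpace E3 X
  intro x₀ hx₀
  have hf0 : f x₀ ≠ 0 := fun h0 => by simpa [h0] using hf1 x₀ hx₀
  obtain ⟨a, ha⟩ := exists_turn_eq (hf1 x₀ hx₀)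
  let V : Set X := U ∩ (fun x => f x / f x₀) ⁻¹' Complex.slitPlane
  have hVo : IsOpen V := (hf.continuousOn.div_const _).isOpen_inter_preimage hU
    Complex.isOpen_slitPlane
  have hx₀V : x₀ ∈ V := ⟨hx₀, by simp [div_self hf0]⟩
  let η : X → ℝ := fun x => (Complex.log (f x / f x₀)).im / (2 * Real.pi)
  have hη : ContMDiffOn (𝓡 3) 𝓘(ℝ, ℝ) ∞ η V := by
    intro x hx
    have h1 : ContDiffAt ℝ ∞ (fun z : ℂ => (Complex.log (z / f x₀)).im / (2 * Real.pi)) (f x) := by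
      have h2 : ContDiffAt ℝ ∞ (fun z : ℂ => Complex.log (z / f x₀)) (f x) :=
        ((Complex.contDiffAt_log hx.2).restrict_scalars ℝ).comp (f x)
          (contDiffAt_id.div_const _)
      exact (Complex.imCLM.contDiff.contDiffAt.comp _ h2).div_const _
    exact h1.contMDiffAt.comp_contMDiffWithinAt x ((hf x hx.1).mono Set.inter_subset_left)
  have hηturn : ∀ x ∈ V, turn (η x) = f x / f x₀ := fun x hx => by
    have hn : ‖f x / f x₀‖ = 1 := by rw [norm_div, hf1 x hx.1, hf1 x₀ hx₀, div_one]
    have h0 : f x / f x₀ ≠ 0 := fun h0 => by simp [h0] at hn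
    rw [turn_div_two_pi, Complex.log_im]
    have := Complex.norm_mul_exp_arg_mul_I (f x / f x₀)
    rwa [hn, Complex.ofReal_one, one_mul] at this
  obtain ⟨W, ⟨hW, hWc⟩, hWV⟩ :=
    (path_connected_basis x₀).mem_iff.1 (hVo.mem_nhds hx₀V)
  have hη0 : η x₀ = 0 := by simp [η, div_self hf0]
  have heq : ∀ x ∈ W, h x = h x₀ + η x := by
    intro x hx
    obtain ⟨γ, hγ⟩ := hWc.joinedIn x₀ (mem_of_mem_nhds hW) x hx
    have hγV : ∀ t, pathSimplex γ t ∈ V := fun t => hWV (hγ _)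
    have h1 := hh (pathSimplex γ) fun t => (hγV t).1
    have hc : Continuous fun t => η (pathSimplex γ t) :=
      hη.continuousOn.comp_continuous (pathSimplex γ).continuous hγV
    rw [variation_eq_of_lift (θ := fun t => a + η (pathSimplex γ t))
      (continuous_const.add hc) fun t => by
      rw [turn_add, ha, hηturn _ (hγV t), mul_div_cancel₀ _ hf0]] at h1
    simp only [pathSimplex_vertex_one, pathSimplex_vertex_zero, hη0] at h1
    linarith
  have h1 : ContMDiffAt (𝓡 3) 𝓘(ℝ, ℝ) ∞ (fun x => h x₀ + η x) x₀ :=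
    (contMDiffAt_const).add ((hη x₀ hx₀V).contMDiffAt (hVo.mem_nhds hx₀V))
  exact (h1.congr_of_eventuallyEq (Filter.eventually_of_mem hW heq)).contMDiffWithinAt

/-! ### Oriented orthonormal frames of a three-dimensional space -/

section LinearAlgebra

variable {V : Type*} [AddCommGroup V] [Module ℝ V]

theorem orientation_eq_iff_of_plane (b b' : Module.Basis (Fin 3) ℝ V) {α β γ δ : ℝ}
    (h0 : b' 0 = α • b 0 + β • b 1) (h1 : b' 1 = γ • b 0 + δ • b 1) (h2 : b' 2 = b 2) :
    b.orientation = b'.orientation ↔ 0 < α * δ - β * γ := by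
  rw [b.orientation_eq_iff_det_pos, Module.Basis.det_apply, Matrix.det_fin_three]
  simp [Module.Basis.toMatrix_apply, h0, h1, h2]
  rw [mul_comm γ β]

variable (B : V →ₗ[ℝ] V →ₗ[ℝ] ℝ)

/-- `v` is orthonormal for the bilinear form `B`. -/
def IsOrthonormal (v : Fin 3 → V) : Prop := ∀ i j, B (v i) (v j) = if i = j then 1 else 0

variable {B}

theorem IsOrthonormal.linearIndependent {v : Fin 3 → V} (hv : IsOrthonormal B v) :
    LinearIndependent ℝ v := by
  rw [Fintype.linearIndependent_iff]
  intro c hc i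
  have := congrArg (B (v i)) hc
  simpa [hv i] using this

/-- The basis given by an orthonormal family. -/
def IsOrthonormal.basis {v : Fin 3 → V} (hv : IsOrthonormal B v) (hV : Module.finrank ℝ V = 3) :
    Module.Basis (Fin 3) ℝ V :=
  basisOfLinearIndependentOfCardEqFinrank hv.linearIndependent (by simp [hV])

@[simp]
theorem IsOrthonormal.basis_apply {v : Fin 3 → V} (hv : IsOrthonormal B v)
    (hV : Module.finrank ℝ V = 3) (i : Fin 3) : hv.basis hV i = v i := by
  simp [IsOrthonormal.basis]

theorem IsOrthonormal.eq_sum {v : Fin 3 → V} (hv : IsOrthonormal B v)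
    (hV : Module.finrank ℝ V = 3) (y : V) : y = ∑ i, B (v i) y • v i := by
  have h := (hv.basis hV).sum_repr y
  simp only [hv.basis_apply] at h
  have h2 : ∀ i, B (v i) y = (hv.basis hV).repr y i := fun i => by
    have := congrArg (B (v i)) h
    simpa [hv i] using this.symm
  simp only [h2, h]

theorem exists_unit_of_finrank_lt (hpos : ∀ v, v ≠ 0 → 0 < B v v) {n : ℕ} (x : Fin n → V)
    [FiniteDimensional ℝ V] (hn : n < Module.finrank ℝ V) :
    ∃ w, B w w = 1 ∧ ∀ i, B (x i) w = 0 := by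
  let L : V →ₗ[ℝ] (Fin n → ℝ) := LinearMap.pi fun i => B (x i)
  have hL : LinearMap.ker L ≠ ⊥ := LinearMap.ker_ne_bot_of_finrank_lt (by simpa using hn)
  obtain ⟨y, hy, hy0⟩ := Submodule.exists_mem_ne_zero_of_ne_bot hL
  have hp := hpos y hy0
  refine ⟨(Real.sqrt (B y y))⁻¹ • y, ?_, fun i => ?_⟩
  · simp only [map_smul, LinearMap.smul_apply, smul_eq_mul]
    rw [← mul_assoc, ← mul_inv, Real.mul_self_sqrt hp.le, inv_mul_cancel₀ hp.ne']
  · have : B (x i) y = 0 := congrFun (LinearMap.mem_ker.1 hy) i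
    simp [this]

end LinearAlgebra

namespace ChartAtInfinity

variable {M : Type u} [TopologicalSpace M] [ChartedSpace E3 M] [IsManifold (𝓡 3) ∞ M] [T2Space M]

instance (m : M) : FiniteDimensional ℝ (TangentSpace (𝓡 3) m) :=
  inferInstanceAs (FiniteDimensional ℝ E3)

theorem finrank_tangentSpace (m : M) : Module.finrank ℝ (TangentSpace (𝓡 3) m) = 3 :=
  (finrank_euclideanSpace_fin : Module.finrank ℝ E3 = 3)

theorem mfderiv_val_bijective (pt : M) (m : punctured pt) :
    Function.Bijective (mfderiv (𝓡 3) (𝓡 3) (Subtype.val : punctured pt → M) m) := by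
  let Φ := (punctured pt).openPartialHomeomorphSubtypeCoe ⟨m⟩
  have hΦ : Φ.MDifferentiable (𝓡 3) (𝓡 3) := by
    refine ⟨(contMDiff_subtype_val (n := ∞)).mdifferentiable (by simp) |>.mdifferentiableOn, ?_⟩
    intro x hx
    have : ContMDiffWithinAt (𝓡 3) (𝓡 3) ∞ Φ.symm Φ.target x := by
      rw [← ContMDiffWithinAt.subtypeVal_comp_iff]
      exact contMDiffWithinAt_id.congr (fun y hy => Φ.right_inv hy) (Φ.right_inv hx)
    exact this.mdifferentiableWithinAt (by simp)
  exact hΦ.mfderiv_bijective (x := m) (by simp [Φ])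

/-- The differential of the inclusion of `M ∖ {pt}` in `M`. -/
def dval (pt : M) (m : punctured pt) :
    TangentSpace (𝓡 3) m ≃ₗ[ℝ] TangentSpace (𝓡 3) (m : M) :=
  LinearEquiv.ofBijective
    (mfderiv (𝓡 3) (𝓡 3) (Subtype.val : punctured pt → M) m).toLinearMap
    (mfderiv_val_bijective pt m)

theorem isPositiveFrame_iff (o : ManifoldOrientation M) {pt : M} (m : punctured pt)
    (b : Module.Basis (Fin 3) ℝ (TangentSpace (𝓡 3) m)) :
    IsPositiveFrame o m b ↔
      b.orientation = (Orientation.map (Fin 3) (dval pt m)).symm (o.orient m) := by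
  rw [Equiv.eq_symm_apply, ← Module.Basis.orientation_map]
  constructor
  · rintro ⟨b', hb', ho⟩
    have : b' = b.map (dval pt m) := by
      ext1 i
      rw [hb']
      rfl
    rw [← this, ho]
  · intro h
    exact ⟨b.map (dval pt m), fun i => rfl, h⟩

variable {o : ManifoldOrientation M} (φ : ChartAtInfinity o) (g : φ.RiemMetric)
  (X : ∀ m : φ.Mcheck, TangentSpace (𝓡 3) m)

/-- The metric at `m`, as a bilinear form. -/
def bilin (m : φ.Mcheck) : TangentSpace (𝓡 3) m →ₗ[ℝ] TangentSpace (𝓡 3) m →ₗ[ℝ] ℝ :=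
  (g.inner m).toLinearMap₁₂

@[simp]
theorem bilin_apply (m : φ.Mcheck) (v w : TangentSpace (𝓡 3) m) :
    φ.bilin g m v w = g.inner m v w := rfl

/-- `(e, w, X)` is a positive orthonormal frame at `m`. -/
structure IsPosFrame (m : φ.Mcheck) (e w : TangentSpace (𝓡 3) m) : Prop where
  orthonormal : IsOrthonormal (φ.bilin g m) ![e, w, X m]
  positive : IsPositiveFrame o m ![e, w, X m]

variable {φ g X}

theorem isOrthonormal_iff {m : φ.Mcheck} {e w : TangentSpace (𝓡 3) m}
    (hX : g.inner m (X m) (X m) = 1) :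
    IsOrthonormal (φ.bilin g m) ![e, w, X m] ↔
      g.inner m e e = 1 ∧ g.inner m w w = 1 ∧ g.inner m e w = 0 ∧ g.inner m e (X m) = 0 ∧
        g.inner m w (X m) = 0 := by
  constructor
  · intro h
    exact ⟨by simpa using h 0 0, by simpa using h 1 1, by simpa using h 0 1,
      by simpa using h 0 2, by simpa using h 1 2⟩
  · rintro ⟨h1, h2, h3, h4, h5⟩ i j
    fin_cases i <;> fin_cases j <;>
      simp [h1, h2, h3, h4, h5, hX, g.symm m w e, g.symm m (X m) e, g.symm m (X m) w]

/-- For an orthonormal frame `(e, w, X)`, positivity is an equality of orientations. -/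
theorem IsPosFrame.iff_orientation {m : φ.Mcheck} {e w : TangentSpace (𝓡 3) m}
    (h : IsOrthonormal (φ.bilin g m) ![e, w, X m]) :
    φ.IsPosFrame g X m e w ↔ (h.basis (finrank_tangentSpace m)).orientation =
      (Orientation.map (Fin 3) (dval φ.infty m)).symm (o.orient m) := by
  rw [← isPositiveFrame_iff]
  have : (⇑(h.basis (finrank_tangentSpace m))) = ![e, w, X m] := by
    ext1 i
    simp
  rw [this]
  exact ⟨fun h => h.positive, fun h' => ⟨h, h'⟩⟩

theorem exists_isPosFrame {m : φ.Mcheck} (hX : g.inner m (X m) (X m) = 1) :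
    ∃ e w : TangentSpace (𝓡 3) m, φ.IsPosFrame g X m e w := by
  have hpos := g.pos m
  obtain ⟨e, he, he'⟩ := exists_unit_of_finrank_lt (B := φ.bilin g m) hpos ![X m]
    (by rw [finrank_tangentSpace]; norm_num)
  obtain ⟨w, hw, hw'⟩ := exists_unit_of_finrank_lt (B := φ.bilin g m) hpos ![e, X m]
    (by rw [finrank_tangentSpace]; norm_num)
  have h1 : g.inner m (X m) e = 0 := by simpa using he' 0
  have h2 : g.inner m e w = 0 := by simpa using hw' 0
  have h3 : g.inner m (X m) w = 0 := by simpa using hw' 1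
  have ho : IsOrthonormal (φ.bilin g m) ![e, w, X m] :=
    (isOrthonormal_iff hX).2 ⟨he, hw, h2, by rw [g.symm, h1], by rw [g.symm, h3]⟩
  have ho' : IsOrthonormal (φ.bilin g m) ![e, -w, X m] :=
    (isOrthonormal_iff hX).2 ⟨he, by simpa using hw, by simpa using h2, by rw [g.symm, h1],
      by simp [g.symm m w, h3]⟩
  by_cases hor : (ho.basis (finrank_tangentSpace m)).orientation =
      (Orientation.map (Fin 3) (dval φ.infty m)).symm (o.orient m)
  · exact ⟨e, w, (IsPosFrame.iff_orientation ho).2 hor⟩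
  · refine ⟨e, -w, (IsPosFrame.iff_orientation ho').2 ?_⟩
    have hne : (ho.basis (finrank_tangentSpace m)).orientation ≠
        (ho'.basis (finrank_tangentSpace m)).orientation := by
      rw [Ne, orientation_eq_iff_of_plane (α := 1) (β := 0) (γ := 0) (δ := -1)] <;> simp
    rcases (ho'.basis (finrank_tangentSpace m)).orientation_eq_or_eq_neg
      ((Orientation.map (Fin 3) (dval φ.infty m)).symm (o.orient m)) with h | h
    · exact h.symm
    · refine absurd ?_ hne
      rcases (ho.basis (finrank_tangentSpace m)).orientation_eq_or_eq_neg
        ((Orientation.map (Fin 3) (dval φ.infty m)).symm (o.orient m)) with h' | h'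
      · exact absurd h'.symm hor
      · exact neg_injective (h'.symm.trans h)

theorem IsPosFrame.rotate {m : φ.Mcheck} {e w : TangentSpace (𝓡 3) m}
    (h : φ.IsPosFrame g X m e w) {a b : ℝ} (hab : a ^ 2 + b ^ 2 = 1) :
    φ.IsPosFrame g X m (a • e + b • w) (-b • e + a • w) := by
  have hX : g.inner m (X m) (X m) = 1 := by simpa using h.orthonormal 2 2
  obtain ⟨h1, h2, h3, h4, h5⟩ := (isOrthonormal_iff hX).1 h.orthonormal
  have h3' : g.inner m w e = 0 := by rw [g.symm, h3]
  have ho : IsOrthonormal (φ.bilin g m) ![a • e + b • w, -b • e + a • w, X m] := by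
    refine (isOrthonormal_iff hX).2 ⟨?_, ?_, ?_, ?_, ?_⟩ <;>
      simp [h1, h2, h3, h3', h4, h5] <;> linarith
  rw [IsPosFrame.iff_orientation ho, ← (IsPosFrame.iff_orientation h.orthonormal).1 h, eq_comm,
    orientation_eq_iff_of_plane (α := a) (β := b) (γ := -b) (δ := a)] <;> simp
  nlinarith

theorem IsPosFrame.expand {m : φ.Mcheck} {e w : TangentSpace (𝓡 3) m}
    (h : φ.IsPosFrame g X m e w) {v : TangentSpace (𝓡 3) m} (hv : g.inner m v (X m) = 0) :
    v = g.inner m v e • e + g.inner m v w • w := by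
  have := h.orthonormal.eq_sum (finrank_tangentSpace m) v
  simpa [Fin.sum_univ_three, g.symm m _ v, hv] using this

theorem IsPosFrame.unique {m : φ.Mcheck} {e w w' : TangentSpace (𝓡 3) m}
    (h : φ.IsPosFrame g X m e w) (h' : φ.IsPosFrame g X m e w') : w' = w := by
  have hX : g.inner m (X m) (X m) = 1 := by simpa using h.orthonormal 2 2
  obtain ⟨h1, h2, h3, h4, h5⟩ := (isOrthonormal_iff hX).1 h.orthonormal
  obtain ⟨h1', h2', h3', h4', h5'⟩ := (isOrthonormal_iff hX).1 h'.orthonormal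
  set b := g.inner m w' w with hb
  have hw : w' = b • w := by
    have := h.expand h5'
    rwa [g.symm, h3', zero_smul, zero_add] at this
  have hpos : 0 < b := by
    have ho := ((IsPosFrame.iff_orientation h.orthonormal).1 h).trans
      ((IsPosFrame.iff_orientation h'.orthonormal).1 h').symm
    have := (orientation_eq_iff_of_plane _ _ (α := 1) (β := 0) (γ := 0) (δ := b)
      (by simp) (by simpa using hw) (by simp)).1 ho
    linarith
  have hb1 : b = 1 := by
    have : b * b = 1 := by
      rw [hw] at h2'
      simpa [h2] using h2'
    nlinarith
  rw [hw, hb1, one_smul]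

/-- A vector orthogonal to `X`, as a complex number, in the frame `(e, w)` of the plane orthogonal
to `X`. -/
def planeCoord (g : φ.RiemMetric) (m : φ.Mcheck) (e w v : TangentSpace (𝓡 3) m) : ℂ :=
  ⟨g.inner m v e, g.inner m v w⟩

/-- A change of positive orthonormal frame is the multiplication by a unit complex number. -/
theorem IsPosFrame.planeCoord_eq {m : φ.Mcheck} {e w e' w' v : TangentSpace (𝓡 3) m}
    (h : φ.IsPosFrame g X m e w) (h' : φ.IsPosFrame g X m e' w') :
    planeCoord g m e w v = planeCoord g m e w e' * planeCoord g m e' w' v ∧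
      ‖planeCoord g m e w e'‖ = 1 := by
  have hX : g.inner m (X m) (X m) = 1 := by simpa using h.orthonormal 2 2
  obtain ⟨h1, h2, h3, h4, h5⟩ := (isOrthonormal_iff hX).1 h.orthonormal
  obtain ⟨h1', h2', h3', h4', h5'⟩ := (isOrthonormal_iff hX).1 h'.orthonormal
  have h6 : g.inner m w e = 0 := by rw [g.symm, h3]
  set a := g.inner m e' e with ha
  set b := g.inner m e' w with hb
  have he : e' = a • e + b • w := h.expand h4'
  have hab : a ^ 2 + b ^ 2 = 1 := by
    have := h1'
    rw [he] at this
    simp [h1, h2, h3, h6] at this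
    linarith
  have hw : w' = -b • e + a • w := by
    have := h.rotate hab
    rw [← he] at this
    exact this.unique h'
  constructor
  · have hwv : g.inner m v w' = -b * g.inner m v e + a * g.inner m v w := by
      rw [hw]
      simp
    have hev : g.inner m v e' = a * g.inner m v e + b * g.inner m v w := by
      rw [he]
      simp
    apply Complex.ext
    · simp only [planeCoord, Complex.mul_re, ← ha, ← hb, hwv, hev]
      linear_combination (-g.inner m v e) * hab
    · simp only [planeCoord, Complex.mul_im, ← ha, ← hb, hwv, hev]
      linear_combination (-g.inner m v w) * hab
  · rw [← sq_eq_sq₀ (norm_nonneg _) zero_le_one, Complex.sq_norm, Complex.normSq_apply]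
    simp only [planeCoord, ← ha, ← hb]
    linarith

end ChartAtInfinity

/-! ### Smooth positive orthonormal frames -/

section VectorFields

variable {N : Type*} [TopologicalSpace N] [ChartedSpace E3 N] [IsManifold (𝓡 3) ∞ N]
  {E' H P : Type*} [NormedAddCommGroup E'] [NormedSpace ℝ E'] [TopologicalSpace H]
  {J : ModelWithCorners ℝ E' H} [TopologicalSpace P] [ChartedSpace H P]

theorem contMDiffOn_combination {O : Set P} {q : P → N} {v w : ∀ x, TangentSpace (𝓡 3) (q x)}
    {α β : P → ℝ}
    (hv : ContMDiffOn J (𝓡 3).tangent ∞ (fun x => (⟨q x, v x⟩ : TangentBundle (𝓡 3) N)) O)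
    (hw : ContMDiffOn J (𝓡 3).tangent ∞ (fun x => (⟨q x, w x⟩ : TangentBundle (𝓡 3) N)) O)
    (hα : ContMDiffOn J 𝓘(ℝ, ℝ) ∞ α O) (hβ : ContMDiffOn J 𝓘(ℝ, ℝ) ∞ β O) :
    ContMDiffOn J (𝓡 3).tangent ∞
      (fun x => (⟨q x, α x • v x + β x • w x⟩ : TangentBundle (𝓡 3) N)) O := by
  intro x₀ hx₀
  have hv' := (contMDiffWithinAt_totalSpace (F := E3)).1 (hv x₀ hx₀)
  have hw' := (contMDiffWithinAt_totalSpace (F := E3)).1 (hw x₀ hx₀)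
  refine (contMDiffWithinAt_totalSpace (F := E3)).2 ⟨hv'.1, ?_⟩
  set e := trivializationAt E3 (TangentSpace (𝓡 3) : N → Type _) (q x₀) with he
  have hlin : ∀ x, q x ∈ e.baseSet →
      (e ⟨q x, α x • v x + β x • w x⟩).2 = α x • (e ⟨q x, v x⟩).2 + β x • (e ⟨q x, w x⟩).2 := by
    intro x hx
    rw [(e.linear ℝ hx).1, (e.linear ℝ hx).2, (e.linear ℝ hx).2]
  refine (((hα x₀ hx₀).smul hv'.2).add ((hβ x₀ hx₀).smul hw'.2)).congr_of_eventuallyEq ?_ ?_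
  · have : q ⁻¹' e.baseSet ∈ 𝓝[O] x₀ := hv'.1.continuousWithinAt.preimage_mem_nhdsWithin
      (e.open_baseSet.mem_nhds (mem_baseSet_trivializationAt E3 _ (q x₀)))
    filter_upwards [this] with x hx using hlin x hx
  · exact hlin x₀ (mem_baseSet_trivializationAt E3 _ (q x₀))

/-- Every tangent vector extends to a smooth local vector field. -/
theorem exists_local_extension (m₀ : N) (a : TangentSpace (𝓡 3) m₀) :
    ∃ U : Set N, IsOpen U ∧ m₀ ∈ U ∧ ∃ s : ∀ m : N, TangentSpace (𝓡 3) m, s m₀ = a ∧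
      ContMDiffOn (𝓡 3) (𝓡 3).tangent ∞ (fun m => (⟨m, s m⟩ : TangentBundle (𝓡 3) N)) U := by
  set e := trivializationAt E3 (TangentSpace (𝓡 3) : N → Type _) m₀ with he
  have hm : m₀ ∈ e.baseSet := mem_baseSet_trivializationAt E3 _ m₀
  refine ⟨e.baseSet, e.open_baseSet, hm, fun m => e.symm m (e ⟨m₀, a⟩).2, ?_, ?_⟩
  · exact e.symm_apply_apply_mk hm a
  · refine (e.contMDiffOn_section_baseSet_iff).2 ((contMDiffOn_const (c := (e ⟨m₀, a⟩).2)).congr ?_)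
    intro y hy
    rw [e.apply_mk_symm hy]

end VectorFields

namespace ChartAtInfinity

variable {M : Type u} [TopologicalSpace M] [ChartedSpace E3 M] [IsManifold (𝓡 3) ∞ M] [T2Space M]
  {o : ManifoldOrientation M} {φ : ChartAtInfinity o} {g : φ.RiemMetric}
  {X : ∀ m : φ.Mcheck, TangentSpace (𝓡 3) m}
  {E' H P : Type*} [NormedAddCommGroup E'] [NormedSpace ℝ E'] [TopologicalSpace H]
  {J : ModelWithCorners ℝ E' H} [TopologicalSpace P] [ChartedSpace H P]

theorem contMDiffOn_inner {O : Set P} {q : P → φ.Mcheck} {v w : ∀ x, TangentSpace (𝓡 3) (q x)}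
    (hv : ContMDiffOn J (𝓡 3).tangent ∞ (fun x => (⟨q x, v x⟩ : TangentBundle (𝓡 3) φ.Mcheck)) O)
    (hw : ContMDiffOn J (𝓡 3).tangent ∞ (fun x => (⟨q x, w x⟩ : TangentBundle (𝓡 3) φ.Mcheck)) O) :
    ContMDiffOn J 𝓘(ℝ, ℝ) ∞ (fun x => g.inner (q x) (v x) (w x)) O := by
  let : RiemannianBundle (fun m : φ.Mcheck => TangentSpace (𝓡 3) m) := ⟨g.toRiemannianMetric⟩
  exact ContMDiffOn.inner_bundle hv hw

theorem continuousOn_inner {Y : Type*} [TopologicalSpace Y] {O : Set Y} {q : Y → φ.Mcheck}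
    {v w : ∀ x, TangentSpace (𝓡 3) (q x)}
    (hv : ContinuousOn (fun x => (⟨q x, v x⟩ : TangentBundle (𝓡 3) φ.Mcheck)) O)
    (hw : ContinuousOn (fun x => (⟨q x, w x⟩ : TangentBundle (𝓡 3) φ.Mcheck)) O) :
    ContinuousOn (fun x => g.inner (q x) (v x) (w x)) O := by
  let : RiemannianBundle (fun m : φ.Mcheck => TangentSpace (𝓡 3) m) :=
    ⟨g.toContinuousRiemannianMetric.toRiemannianMetric⟩
  exact ContinuousOn.inner_bundle hv hw

/-- The determinant of three vectors of `ℝ³`. -/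
def det3 (v : Fin 3 → E3) : ℝ := Matrix.det (Matrix.of fun i j => v j i)

theorem continuous_det3 : Continuous det3 := by
  unfold det3
  fun_prop

theorem det3_eq (v : Fin 3 → E3) :
    det3 v = (EuclideanSpace.basisFun (Fin 3) ℝ).toBasis.det v := by
  rw [Module.Basis.det_apply, det3]
  congr 1

theorem orientation_eq_iff_det3 (b b' : Module.Basis (Fin 3) ℝ E3) :
    b.orientation = b'.orientation ↔ 0 < det3 b * det3 b' := by
  set c := (EuclideanSpace.basisFun (Fin 3) ℝ).toBasis
  have h : c.det b' = c.det b * b.det b' := by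
    simp only [Module.Basis.det_apply]
    rw [← Matrix.det_mul, Module.Basis.toMatrix_mul_toMatrix]
  have h0 : c.det b ≠ 0 := (c.isUnit_det b).ne_zero
  rw [b.orientation_eq_iff_det_pos, det3_eq, det3_eq, h, ← mul_assoc]
  exact (mul_pos_iff_of_pos_left (mul_self_pos.2 h0)).symm

/-- A smooth orthonormal frame that is positive at a point is positive in a neighbourhood. -/
theorem exists_isPosFrame_nhds {U : Set φ.Mcheck} (hU : IsOpen U)
    {v : Fin 3 → ∀ m : φ.Mcheck, TangentSpace (𝓡 3) m}
    (hv : ∀ i, ContMDiffOn (𝓡 3) (𝓡 3).tangent ∞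
      (fun m => (⟨m, v i m⟩ : TangentBundle (𝓡 3) φ.Mcheck)) U)
    (ho : ∀ m ∈ U, IsOrthonormal (φ.bilin g m) (fun i => v i m)) {m₀ : φ.Mcheck} (hm₀ : m₀ ∈ U)
    (hpos : IsPositiveFrame o m₀ (fun i => v i m₀)) :
    ∀ᶠ m in 𝓝 m₀, IsPositiveFrame o m (fun i => v i m) := by
  obtain ⟨N, hN, s, hs, hsb⟩ := o.locally_frame (m₀ : M)
  set e := trivializationAt E3 (TangentSpace (𝓡 3) : M → Type _) (m₀ : M) with he
  have hm : (m₀ : M) ∈ e.baseSet := mem_baseSet_trivializationAt E3 _ (m₀ : M)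
  let D₁ : φ.Mcheck → ℝ := fun m => det3 fun i => (e ⟨(m : M), dval _ m (v i m)⟩).2
  let D₂ : φ.Mcheck → ℝ := fun m => det3 fun i => (e ⟨(m : M), s i m⟩).2
  have hsnd : ContinuousOn (fun p => (e p).2) e.source := continuous_snd.comp_continuousOn e.continuousOn
  have hc₁ : ContinuousAt D₁ m₀ := by
    refine continuous_det3.continuousAt.comp (continuousAt_pi.2 fun i => ?_)
    have h1 : ContinuousAt (fun m : φ.Mcheck => (⟨(m : M), dval _ m (v i m)⟩ : TangentBundle (𝓡 3) M))
        m₀ := by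
      have h2 : Continuous (tangentMap (𝓡 3) (𝓡 3) (Subtype.val : φ.Mcheck → M)) :=
        (contMDiff_subtype_val (n := ∞)).continuous_tangentMap (by simp)
      exact h2.continuousAt.comp ((hv i).continuousOn.continuousAt (hU.mem_nhds hm₀))
    exact (hsnd.continuousAt (e.open_source.mem_nhds (e.mem_source.2 hm))).comp
      (f := fun m : φ.Mcheck => (⟨(m : M), dval _ m (v i m)⟩ : TangentBundle (𝓡 3) M)) h1
  have hc₂ : ContinuousAt D₂ m₀ := by
    refine continuous_det3.continuousAt.comp (continuousAt_pi.2 fun i => ?_)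
    have h1 : ContinuousAt (fun m : φ.Mcheck => (⟨(m : M), s i m⟩ : TangentBundle (𝓡 3) M)) m₀ :=
      ((hs i).continuousAt hN).comp (f := Subtype.val) continuous_subtype_val.continuousAt
    exact (hsnd.continuousAt (e.open_source.mem_nhds (e.mem_source.2 hm))).comp
      (f := fun m : φ.Mcheck => (⟨(m : M), s i m⟩ : TangentBundle (𝓡 3) M)) h1
  have hkey : ∀ m ∈ U, (m : M) ∈ N → (m : M) ∈ e.baseSet →
      (IsPositiveFrame o m (fun i => v i m) ↔ 0 < D₁ m * D₂ m) := by
    intro m hmU hmN hme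
    obtain ⟨b', hb', ho'⟩ := hsb m hmN
    let b := (ho m hmU).basis (finrank_tangentSpace m)
    have hb : ⇑b = fun i => v i m := by
      ext1 i
      exact (ho m hmU).basis_apply _ i
    let L := e.linearEquivAt ℝ (m : M) hme
    rw [← hb, isPositiveFrame_iff, Equiv.eq_symm_apply, ← Module.Basis.orientation_map, ← ho',
      ← (Orientation.map (Fin 3) L).injective.eq_iff, ← Module.Basis.orientation_map,
      ← Module.Basis.orientation_map]
    refine (orientation_eq_iff_det3 _ _).trans ?_
    have h1 : (⇑((b.map (dval φ.infty m)).map L) : Fin 3 → E3) =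
        fun i => (e ⟨(m : M), dval _ m (v i m)⟩).2 := by
      ext1 i
      simp only [Module.Basis.map_apply, hb]
      rfl
    have h2 : (⇑(b'.map L) : Fin 3 → E3) = fun i => (e ⟨(m : M), s i m⟩).2 := by
      ext1 i
      simp only [Module.Basis.map_apply, hb']
      rfl
    rw [h1, h2]
  have h0 : 0 < D₁ m₀ * D₂ m₀ := (hkey m₀ hm₀ (mem_of_mem_nhds hN) hm).1 hpos
  filter_upwards [(hc₁.mul hc₂).eventually (lt_mem_nhds h0), hU.mem_nhds hm₀,
    continuous_subtype_val.continuousAt.preimage_mem_nhds hN,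
    continuous_subtype_val.continuousAt.preimage_mem_nhds (e.open_baseSet.mem_nhds hm)]
    with m h1 h2 h3 h4
  exact (hkey m h2 h3 h4).2 h1

end ChartAtInfinity

namespace ChartAtInfinity

variable {M : Type u} [TopologicalSpace M] [ChartedSpace E3 M] [IsManifold (𝓡 3) ∞ M] [T2Space M]
  {o : ManifoldOrientation M} {φ : ChartAtInfinity o} {g : φ.RiemMetric}
  {X : ∀ m : φ.Mcheck, TangentSpace (𝓡 3) m}

/-- The tangent vector field `v` is smooth on `U`. -/
def IsSmoothField (v : ∀ m : φ.Mcheck, TangentSpace (𝓡 3) m) (U : Set φ.Mcheck) : Prop :=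
  ContMDiffOn (𝓡 3) (𝓡 3).tangent ∞ (fun m => (⟨m, v m⟩ : TangentBundle (𝓡 3) φ.Mcheck)) U

theorem IsSmoothField.inner {v w : ∀ m : φ.Mcheck, TangentSpace (𝓡 3) m} {U : Set φ.Mcheck}
    (hv : IsSmoothField v U) (hw : IsSmoothField w U) :
    ContMDiffOn (𝓡 3) 𝓘(ℝ, ℝ) ∞ (fun m => g.inner m (v m) (w m)) U :=
  contMDiffOn_inner hv hw

theorem IsSmoothField.combination {v w : ∀ m : φ.Mcheck, TangentSpace (𝓡 3) m}
    {α β : φ.Mcheck → ℝ} {U : Set φ.Mcheck} (hv : IsSmoothField v U) (hw : IsSmoothField w U)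
    (hα : ContMDiffOn (𝓡 3) 𝓘(ℝ, ℝ) ∞ α U) (hβ : ContMDiffOn (𝓡 3) 𝓘(ℝ, ℝ) ∞ β U) :
    IsSmoothField (fun m => α m • v m + β m • w m) U :=
  contMDiffOn_combination (q := fun m => m) hv hw hα hβ

/-- The component of `v` orthogonal to the unit vector field `x`, written as a combination of `v` and
`x` with function coefficients. -/
def orthoPart (g : φ.RiemMetric) (x v : ∀ m : φ.Mcheck, TangentSpace (𝓡 3) m) (m : φ.Mcheck) :
    TangentSpace (𝓡 3) m :=
  (1 : ℝ) • v m + (-g.inner m (v m) (x m)) • x m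

/-- The field `v` divided by its length, written as a combination with function coefficients. -/
def normalized (g : φ.RiemMetric) (v : ∀ m : φ.Mcheck, TangentSpace (𝓡 3) m) (m : φ.Mcheck) :
    TangentSpace (𝓡 3) m :=
  (Real.sqrt (g.inner m (v m) (v m)))⁻¹ • v m + (0 : ℝ) • v m

theorem IsSmoothField.orthoPart {v x : ∀ m : φ.Mcheck, TangentSpace (𝓡 3) m} {U : Set φ.Mcheck}
    (hv : IsSmoothField v U) (hx : IsSmoothField x U) : IsSmoothField (orthoPart g x v) U :=
  hv.combination hx contMDiffOn_const (hv.inner hx).neg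

theorem IsSmoothField.normalized {v : ∀ m : φ.Mcheck, TangentSpace (𝓡 3) m} {U : Set φ.Mcheck}
    (hv : IsSmoothField v U) (hpos : ∀ m ∈ U, 0 < g.inner m (v m) (v m)) :
    IsSmoothField (normalized g v) U := by
  refine hv.combination hv (fun m hm => ?_) contMDiffOn_const
  have h : ContDiffAt ℝ ∞ (fun t : ℝ => (Real.sqrt t)⁻¹) (g.inner m (v m) (v m)) :=
    (Real.contDiffAt_sqrt (hpos m hm).ne').inv (Real.sqrt_pos.2 (hpos m hm)).ne'
  exact h.contMDiffAt.comp_contMDiffWithinAt (f := fun m => g.inner m (v m) (v m)) m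
    (hv.inner hv m hm)

theorem inner_orthoPart_self {v x : ∀ m : φ.Mcheck, TangentSpace (𝓡 3) m} {m : φ.Mcheck}
    (hx : g.inner m (x m) (x m) = 1) : g.inner m (orthoPart g x v m) (x m) = 0 := by
  simp [orthoPart, hx]

theorem inner_orthoPart_of_orthogonal {v x y : ∀ m : φ.Mcheck, TangentSpace (𝓡 3) m}
    {m : φ.Mcheck} (hv : g.inner m (v m) (y m) = 0) (hx : g.inner m (x m) (y m) = 0) :
    g.inner m (orthoPart g x v m) (y m) = 0 := by
  simp [orthoPart, hx, hv]

theorem orthoPart_eq_self {v x : ∀ m : φ.Mcheck, TangentSpace (𝓡 3) m} {m : φ.Mcheck}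
    (h : g.inner m (v m) (x m) = 0) : orthoPart g x v m = v m := by
  simp [orthoPart, h]

theorem normalized_eq_self {v : ∀ m : φ.Mcheck, TangentSpace (𝓡 3) m} {m : φ.Mcheck}
    (h : g.inner m (v m) (v m) = 1) : normalized g v m = v m := by
  simp [normalized, h]

theorem inner_normalized_self {v : ∀ m : φ.Mcheck, TangentSpace (𝓡 3) m} {m : φ.Mcheck}
    (h : 0 < g.inner m (v m) (v m)) :
    g.inner m (normalized g v m) (normalized g v m) = 1 := by
  simp only [normalized, zero_smul, add_zero, map_smul, smul_apply, smul_eq_mul]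
  rw [← mul_assoc, ← mul_inv, Real.mul_self_sqrt h.le, inv_mul_cancel₀ h.ne']

theorem inner_normalized_of_orthogonal {v x : ∀ m : φ.Mcheck, TangentSpace (𝓡 3) m} {m : φ.Mcheck}
    (h : g.inner m (v m) (x m) = 0) : g.inner m (normalized g v m) (x m) = 0 := by
  simp [normalized, h]

theorem isOpen_inter_pos {v : ∀ m : φ.Mcheck, TangentSpace (𝓡 3) m} {U : Set φ.Mcheck}
    (hU : IsOpen U) (hv : IsSmoothField v U) : IsOpen (U ∩ {m | 0 < g.inner m (v m) (v m)}) :=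
  (hv.inner hv).continuousOn.isOpen_inter_preimage hU isOpen_Ioi

/-- A smooth unit field orthogonal to `X` is locally the first vector of a smooth positive
orthonormal frame `(e, w, X)`. -/
theorem exists_smooth_isPosFrame {U : Set φ.Mcheck} (hU : IsOpen U) (hXs : IsSmoothField X U)
    (hX : ∀ m ∈ U, g.inner m (X m) (X m) = 1) {e : ∀ m : φ.Mcheck, TangentSpace (𝓡 3) m}
    (he : IsSmoothField e U) (he1 : ∀ m ∈ U, g.inner m (e m) (e m) = 1)
    (heX : ∀ m ∈ U, g.inner m (e m) (X m) = 0) {m₀ : φ.Mcheck} (hm₀ : m₀ ∈ U)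
    {w₀ : TangentSpace (𝓡 3) m₀} (hw₀ : φ.IsPosFrame g X m₀ (e m₀) w₀) :
    ∃ V ⊆ U, IsOpen V ∧ m₀ ∈ V ∧ ∃ w : ∀ m : φ.Mcheck, TangentSpace (𝓡 3) m,
      w m₀ = w₀ ∧ IsSmoothField w V ∧ ∀ m ∈ V, φ.IsPosFrame g X m (e m) (w m) := by
  obtain ⟨U', hU', hm₀', b, hb₀, hb⟩ := exists_local_extension m₀ w₀
  obtain ⟨h1, h2, h3, h4, h5⟩ := (isOrthonormal_iff (hX m₀ hm₀)).1 hw₀.orthonormal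
  set V₁ := U ∩ U' with hV₁
  set b₁ := orthoPart g e (orthoPart g X b) with hb₁
  have hb₁s : IsSmoothField b₁ V₁ :=
    ((IsSmoothField.orthoPart (hb.mono Set.inter_subset_right)
      (hXs.mono Set.inter_subset_left)).orthoPart (he.mono Set.inter_subset_left))
  have hb₁m : b₁ m₀ = w₀ := by
    have hXb : orthoPart g X b m₀ = w₀ := by rw [orthoPart_eq_self (by rw [hb₀, h5]), hb₀]
    rw [hb₁, orthoPart_eq_self (by rw [hXb, g.symm, h3]), hXb]
  set V₂ := V₁ ∩ {m | 0 < g.inner m (b₁ m) (b₁ m)} with hV₂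
  have hV₂o : IsOpen V₂ := isOpen_inter_pos (hU.inter hU') hb₁s
  set w := normalized g b₁ with hw
  have hwm : w m₀ = w₀ := by rw [hw, normalized_eq_self (by rw [hb₁m, h2]), hb₁m]
  have hws : IsSmoothField w V₂ :=
    IsSmoothField.normalized (hb₁s.mono Set.inter_subset_left) fun m hm => hm.2
  have hm₂ : m₀ ∈ V₂ := ⟨⟨hm₀, hm₀'⟩, by simp [hb₁m, h2]⟩
  have ho : ∀ m ∈ V₂, IsOrthonormal (φ.bilin g m) ![e m, w m, X m] := by
    intro m hm
    have hmU : m ∈ U := hm.1.1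
    refine (isOrthonormal_iff (hX m hmU)).2 ⟨he1 m hmU, inner_normalized_self hm.2, ?_, heX m hmU, ?_⟩
    · rw [g.symm]
      exact inner_normalized_of_orthogonal (inner_orthoPart_self (he1 m hmU))
    · exact inner_normalized_of_orthogonal (inner_orthoPart_of_orthogonal
        (inner_orthoPart_self (hX m hmU)) (heX m hmU))
  have hvec : ∀ m, (fun i => (![e, w, X] : Fin 3 → ∀ m, TangentSpace (𝓡 3) m) i m) =
      ![e m, w m, X m] := by
    intro m
    ext1 i
    fin_cases i <;> rfl
  have hVU : V₂ ⊆ U := fun m hm => hm.1.1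
  have hp := exists_isPosFrame_nhds (o := o) (g := g) hV₂o (v := ![e, w, X])
    (by
      intro i
      fin_cases i
      · exact he.mono hVU
      · exact hws
      · exact hXs.mono hVU)
    (fun m hm => by rw [hvec]; exact ho m hm) hm₂ (by rw [hvec, hwm]; exact hw₀.positive)
  obtain ⟨V₃, hV₃, hV₃o, hm₃⟩ := eventually_nhds_iff.1 hp
  refine ⟨V₂ ∩ V₃, fun m hm => hVU hm.1, hV₂o.inter hV₃o, ⟨hm₂, hm₃⟩, w, hwm,
    hws.mono Set.inter_subset_left, fun m hm => ⟨ho m hm.1, ?_⟩⟩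
  have := hV₃ m hm.2
  rwa [hvec] at this

/-- Smooth positive orthonormal frames `(e, w, X)` exist locally. -/
theorem exists_local_isPosFrame (hXs : IsSmoothField X Set.univ)
    (hX : ∀ m, g.inner m (X m) (X m) = 1) (m₀ : φ.Mcheck) :
    ∃ V, IsOpen V ∧ m₀ ∈ V ∧ ∃ e w : ∀ m : φ.Mcheck, TangentSpace (𝓡 3) m,
      IsSmoothField e V ∧ IsSmoothField w V ∧ ∀ m ∈ V, φ.IsPosFrame g X m (e m) (w m) := by
  obtain ⟨e₀, w₀, h₀⟩ := exists_isPosFrame (o := o) (hX m₀)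
  obtain ⟨U, hU, hm₀, a, ha₀, ha⟩ := exists_local_extension m₀ e₀
  obtain ⟨h1, h2, h3, h4, h5⟩ := (isOrthonormal_iff (hX m₀)).1 h₀.orthonormal
  set a₁ := orthoPart g X a with ha₁
  have ha₁s : IsSmoothField a₁ U := IsSmoothField.orthoPart ha (hXs.mono (Set.subset_univ _))
  have ha₁m : a₁ m₀ = e₀ := by rw [ha₁, orthoPart_eq_self (by rw [ha₀, h4]), ha₀]
  set e := normalized g a₁ with he
  have hem : e m₀ = e₀ := by rw [he, normalized_eq_self (by rw [ha₁m, h1]), ha₁m]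
  set V := U ∩ {m | 0 < g.inner m (a₁ m) (a₁ m)} with hV
  have hes : IsSmoothField e V := IsSmoothField.normalized (ha₁s.mono Set.inter_subset_left) fun m hm => hm.2
  obtain ⟨V', hV', hV'o, hmV', w, -, hw, hp⟩ := exists_smooth_isPosFrame
    (isOpen_inter_pos hU ha₁s) (hXs.mono (Set.subset_univ _)) (fun m _ => hX m) hes
    (fun m hm => inner_normalized_self hm.2)
    (fun m _ => inner_normalized_of_orthogonal (inner_orthoPart_self (hX m)))
    (m₀ := m₀) ⟨hm₀, by simp [ha₁m, h1]⟩ (by rw [hem]; exact h₀)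
  exact ⟨V', hV'o, hmV', e, w, hes.mono hV', hw, hp⟩

end ChartAtInfinity

namespace ChartAtInfinity

variable {M : Type u} [TopologicalSpace M] [ChartedSpace E3 M] [IsManifold (𝓡 3) ∞ M] [T2Space M]
  {o : ManifoldOrientation M} {φ : ChartAtInfinity o} {g : φ.RiemMetric}
  {X : ∀ m : φ.Mcheck, TangentSpace (𝓡 3) m}

/-! ### Complex coordinates on the circle bundle -/

variable (φ g X) in
/-- A choice, with no regularity, of a positive orthonormal frame `(e, w, X)` at each point. It
identifies the fibres of `UX^⊥` with the unit circle of `ℂ`. -/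
structure RefFrame where
  e : ∀ m : φ.Mcheck, TangentSpace (𝓡 3) m
  w : ∀ m : φ.Mcheck, TangentSpace (𝓡 3) m
  isPosFrame : ∀ m, φ.IsPosFrame g X m (e m) (w m)

theorem exists_refFrame (hX : ∀ m, g.inner m (X m) (X m) = 1) : Nonempty (φ.RefFrame g X) := by
  choose e w h using fun m => exists_isPosFrame (o := o) (hX m)
  exact ⟨⟨e, w, h⟩⟩

namespace RefFrame

variable (R : φ.RefFrame g X)

/-- The coordinate in `ℂ` of a tangent vector orthogonal to `X`. -/
def coord (v : TangentBundle (𝓡 3) φ.Mcheck) : ℂ :=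
  planeCoord g v.proj (R.e v.proj) (R.w v.proj) v.snd

/-- The tangent vector at `m` orthogonal to `X` whose coordinate is `c`. -/
def vec (m : φ.Mcheck) (c : ℂ) : TangentSpace (𝓡 3) m := c.re • R.e m + c.im • R.w m

theorem inner_frame (m : φ.Mcheck) :
    g.inner m (X m) (X m) = 1 ∧ g.inner m (R.e m) (R.e m) = 1 ∧ g.inner m (R.w m) (R.w m) = 1 ∧
      g.inner m (R.e m) (R.w m) = 0 ∧ g.inner m (R.w m) (R.e m) = 0 ∧
      g.inner m (R.e m) (X m) = 0 ∧ g.inner m (R.w m) (X m) = 0 := by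
  have hX : g.inner m (X m) (X m) = 1 := by simpa using (R.isPosFrame m).orthonormal 2 2
  obtain ⟨h1, h2, h3, h4, h5⟩ := (isOrthonormal_iff hX).1 (R.isPosFrame m).orthonormal
  exact ⟨hX, h1, h2, h3, by rw [g.symm, h3], h4, h5⟩

theorem coord_vec (m : φ.Mcheck) (c : ℂ) : R.coord ⟨m, R.vec m c⟩ = c := by
  obtain ⟨-, h1, h2, h3, h4, -, -⟩ := R.inner_frame m
  apply Complex.ext <;> simp [coord, planeCoord, vec, h1, h2, h3, h4]

theorem vec_coord {m : φ.Mcheck} {v : TangentSpace (𝓡 3) m} (hv : g.inner m v (X m) = 0) :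
    R.vec m (R.coord ⟨m, v⟩) = v :=
  ((R.isPosFrame m).expand hv).symm

theorem inner_vec (m : φ.Mcheck) (c : ℂ) :
    g.inner m (R.vec m c) (R.vec m c) = ‖c‖ ^ 2 ∧ g.inner m (R.vec m c) (X m) = 0 := by
  obtain ⟨-, h1, h2, h3, h4, h5, h6⟩ := R.inner_frame m
  rw [Complex.sq_norm, Complex.normSq_apply]
  constructor <;> simp [vec, h1, h2, h3, h4, h5, h6]

/-- The unit vectors of coordinates `c` and `i c` form a positive orthonormal frame. -/
theorem isPosFrame_vec (m : φ.Mcheck) {c : ℂ} (hc : ‖c‖ = 1) :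
    φ.IsPosFrame g X m (R.vec m c) (R.vec m (Complex.I * c)) := by
  have h : c.re ^ 2 + c.im ^ 2 = 1 := by
    have := Complex.sq_norm c
    rw [hc, Complex.normSq_apply] at this
    linarith
  simpa [vec] using (R.isPosFrame m).rotate h

theorem coord_eq_mul {m : φ.Mcheck} {e w v : TangentSpace (𝓡 3) m}
    (h : φ.IsPosFrame g X m e w) :
    R.coord ⟨m, v⟩ = R.coord ⟨m, e⟩ * planeCoord g m e w v ∧ ‖R.coord ⟨m, e⟩‖ = 1 :=
  (R.isPosFrame m).planeCoord_eq h

/-- The element of `UX^⊥` with given base point and coordinate. -/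
def ofCoord (m : φ.Mcheck) (c : ℂ) (hc : ‖c‖ = 1) : φ.UPerp g X :=
  ⟨⟨m, R.vec m c⟩, by rw [(R.inner_vec m c).1, hc, one_pow], (R.inner_vec m c).2⟩

@[simp]
theorem coord_ofCoord (m : φ.Mcheck) (c : ℂ) (hc : ‖c‖ = 1) : R.coord (R.ofCoord m c hc).1 = c :=
  R.coord_vec m c

theorem eq_vec (u : φ.UPerp g X) : u.1 = ⟨u.base, R.vec u.base (R.coord u.1)⟩ :=
  congrArg (fun v => (⟨u.base, v⟩ : TangentBundle (𝓡 3) φ.Mcheck)) (R.vec_coord u.2.2).symm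

theorem norm_coord (u : φ.UPerp g X) : ‖R.coord u.1‖ = 1 := by
  have h := (R.inner_vec u.base (R.coord u.1)).1
  have h2 : R.vec u.base (R.coord u.1) = u.1.snd := R.vec_coord u.2.2
  rw [h2] at h
  rw [← sq_eq_sq₀ (norm_nonneg _) zero_le_one, ← h, one_pow]
  exact u.2.1

theorem coord_ne_zero (u : φ.UPerp g X) : R.coord u.1 ≠ 0 := fun h => by
  simpa [h] using R.norm_coord u

/-- Rotations are multiplications by unit complex numbers. -/
theorem rotates_iff {θ : ℝ} {u u' : φ.UPerp g X} :
    UPerp.Rotates θ u u' ↔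
      u'.base = u.base ∧ R.coord u'.1 = Complex.exp (θ * Complex.I) * R.coord u.1 := by
  have hn := R.norm_coord u
  obtain ⟨⟨m, v⟩, hv1, hv2⟩ := u
  obtain ⟨⟨m', v'⟩, hv1', hv2'⟩ := u'
  change g.inner m v v = 1 at hv1
  change g.inner m v (X m) = 0 at hv2
  change g.inner m' v' (X m') = 0 at hv2'
  change ‖R.coord ⟨m, v⟩‖ = 1 at hn
  obtain ⟨hX, -⟩ := R.inner_frame m
  have hp := R.isPosFrame_vec m hn
  have he : R.vec m (R.coord ⟨m, v⟩) = v := R.vec_coord hv2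
  have hrot : ∀ c : ℂ, R.vec m (c * R.coord ⟨m, v⟩) =
      c.re • v + c.im • R.vec m (Complex.I * R.coord ⟨m, v⟩) := by
    intro c
    nth_rw 2 [← he]
    simp only [vec, Complex.mul_re, Complex.mul_im, Complex.I_re, Complex.I_im]
    module
  have hexp := hrot (Complex.exp (θ * Complex.I))
  rw [Complex.exp_ofReal_mul_I_re θ, Complex.exp_ofReal_mul_I_im θ] at hexp
  rw [he] at hp
  constructor
  · rintro ⟨w, h1, h2, h3, h4, h5⟩
    have hw : w = R.vec m (Complex.I * R.coord ⟨m, v⟩) :=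
      hp.unique ⟨(isOrthonormal_iff hX).2 ⟨hv1, h1, h2, hv2, h3⟩, h4⟩
    change (⟨m', v'⟩ : TangentBundle (𝓡 3) φ.Mcheck) = ⟨m, Real.cos θ • v + Real.sin θ • w⟩ at h5
    have h6 : Real.cos θ • v + Real.sin θ • w =
        R.vec m (Complex.exp (θ * Complex.I) * R.coord ⟨m, v⟩) := by
      subst hw
      exact hexp.symm
    rw [h6] at h5
    have h7 : m' = m := congrArg TotalSpace.proj h5
    have h8 : R.coord ⟨m', v'⟩ = Complex.exp (θ * Complex.I) * R.coord ⟨m, v⟩ :=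
      (congrArg R.coord h5).trans (R.coord_vec _ _)
    exact ⟨h7, h8⟩
  · rintro ⟨hb, hc⟩
    change m' = m at hb
    subst hb
    change R.coord ⟨m', v'⟩ = _ * R.coord ⟨m', v⟩ at hc
    obtain ⟨h1, h2, h3, h4, h5⟩ := (isOrthonormal_iff hX).1 hp.orthonormal
    have h6 : v' = Real.cos θ • v + Real.sin θ • R.vec m' (Complex.I * R.coord ⟨m', v⟩) := by
      exact (R.vec_coord hv2').symm.trans ((congrArg (R.vec m') hc).trans hexp)
    exact ⟨_, h2, h3, h5, hp.positive, congrArg (TotalSpace.mk m') h6⟩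

variable {p : ℕ}

theorem mk_eq_mk_of_pow_eq (hp : 0 < p) {u u' : φ.UPerp g X} (hb : u'.base = u.base)
    (hc : R.coord u'.1 ^ p = R.coord u.1 ^ p) :
    (UPerpMod.mk u : φ.UPerpMod g X p) = UPerpMod.mk u' := by
  have : NeZero p := ⟨hp.ne'⟩
  have h0 := R.coord_ne_zero u
  have h1 : (R.coord u'.1 / R.coord u.1) ^ p = 1 := by
    rw [div_pow, hc, div_self (pow_ne_zero _ h0)]
  obtain ⟨k, -, hk⟩ := (Complex.isPrimitiveRoot_exp p hp.ne').eq_pow_of_pow_eq_one h1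
  refine Quot.sound ⟨k, R.rotates_iff.2 ⟨hb, ?_⟩⟩
  rw [eq_comm, div_eq_iff h0] at hk
  rw [hk, ← Complex.exp_nat_mul]
  congr 2
  push_cast
  ring

/-- The `p`-th power of the coordinate, as a function on `UX^⊥_p`. -/
def coordMod (hp : 0 < p) (x : φ.UPerpMod g X p) : ℂ :=
  Quot.lift (fun u => R.coord u.1 ^ p) (fun u u' ⟨k, h⟩ => by
    have hp' : (p : ℂ) ≠ 0 := by exact_mod_cast hp.ne'
    have h1 : Complex.exp ((2 * Real.pi * k / p : ℝ) * Complex.I) ^ p = 1 := by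
      rw [← Complex.exp_nat_mul, Complex.exp_eq_one_iff]
      refine ⟨k, ?_⟩
      push_cast
      field_simp
    simp only [(R.rotates_iff.1 h).2, mul_pow, h1, one_mul]) x

@[simp]
theorem coordMod_mk (hp : 0 < p) (u : φ.UPerp g X) :
    R.coordMod hp (UPerpMod.mk u : φ.UPerpMod g X p) = R.coord u.1 ^ p := rfl

theorem norm_coordMod (hp : 0 < p) (x : φ.UPerpMod g X p) : ‖R.coordMod hp x‖ = 1 := by
  obtain ⟨u, rfl⟩ := Quot.exists_rep x
  exact (norm_pow _ _).trans (by rw [R.norm_coord, one_pow])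

theorem coordMod_ne_zero (hp : 0 < p) (x : φ.UPerpMod g X p) : R.coordMod hp x ≠ 0 := fun h => by
  simpa [h] using R.norm_coordMod hp x

theorem ext_coordMod (hp : 0 < p) {x x' : φ.UPerpMod g X p} (hb : x'.base = x.base)
    (hc : R.coordMod hp x' = R.coordMod hp x) : x' = x := by
  obtain ⟨u, rfl⟩ := Quot.exists_rep x
  obtain ⟨u', rfl⟩ := Quot.exists_rep x'
  exact (R.mk_eq_mk_of_pow_eq hp hb hc).symm

theorem exists_coordMod (hp : 0 < p) (m : φ.Mcheck) {c : ℂ} (hc : ‖c‖ = 1) :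
    ∃ x : φ.UPerpMod g X p, x.base = m ∧ R.coordMod hp x = c := by
  obtain ⟨a, ha⟩ := exists_turn_eq hc
  have hp' : (p : ℝ) ≠ 0 := by exact_mod_cast hp.ne'
  refine ⟨UPerpMod.mk (R.ofCoord m (turn (a / p)) (norm_turn _)), rfl, ?_⟩
  rw [coordMod_mk, coord_ofCoord, ← turn_natCast_mul, mul_div_cancel₀ _ hp', ha]

/-! ### Smoothness in local gauges -/

/-- `σ` is the coordinate of a smooth local section of `UX^⊥` over `U`. The rotation of this section
by a quarter turn is required to be smooth, too; this is automatic, see `isGauge_of_smooth`. -/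
structure IsGauge (U : Set φ.Mcheck) (σ : φ.Mcheck → ℂ) : Prop where
  norm_eq : ∀ m ∈ U, ‖σ m‖ = 1
  smooth : IsSmoothField (fun m => R.vec m (σ m)) U
  smooth_I : IsSmoothField (fun m => R.vec m (Complex.I * σ m)) U

variable {R}

theorem IsGauge.ne_zero {U : Set φ.Mcheck} {σ : φ.Mcheck → ℂ} (h : R.IsGauge U σ) {m : φ.Mcheck}
    (hm : m ∈ U) : σ m ≠ 0 := fun h0 => by simpa [h0] using h.norm_eq m hm

theorem IsGauge.mono {U V : Set φ.Mcheck} {σ : φ.Mcheck → ℂ} (h : R.IsGauge U σ) (hV : V ⊆ U) :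
    R.IsGauge V σ :=
  ⟨fun m hm => h.norm_eq m (hV hm), ContMDiffOn.mono h.smooth hV, ContMDiffOn.mono h.smooth_I hV⟩

theorem exists_isGauge (hXs : IsSmoothField X Set.univ) (m₀ : φ.Mcheck) :
    ∃ U, IsOpen U ∧ m₀ ∈ U ∧ ∃ σ, R.IsGauge U σ := by
  obtain ⟨U, hU, hm₀, e, w, he, hw, h⟩ :=
    exists_local_isPosFrame hXs (fun m => (R.inner_frame m).1) m₀
  have hvec : ∀ m ∈ U, R.vec m (R.coord ⟨m, e m⟩) = e m := fun m hm =>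
    R.vec_coord ((isOrthonormal_iff (R.inner_frame m).1).1 (h m hm).orthonormal).2.2.2.1
  have hn : ∀ m ∈ U, ‖R.coord ⟨m, e m⟩‖ = 1 := fun m hm =>
    (R.coord_eq_mul (v := e m) (h m hm)).2
  refine ⟨U, hU, hm₀, fun m => R.coord ⟨m, e m⟩, hn, ?_, ?_⟩
  · exact ContMDiffOn.congr he fun m hm => by simp only [hvec m hm]
  · refine ContMDiffOn.congr hw fun m hm => ?_
    have h1 := R.isPosFrame_vec m (hn m hm)
    rw [hvec m hm] at h1
    rw [h1.unique (h m hm)]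

theorem IsGauge.coord_div {U : Set φ.Mcheck} {σ : φ.Mcheck → ℂ} (h : R.IsGauge U σ)
    {m : φ.Mcheck} (hm : m ∈ U) (v : TangentSpace (𝓡 3) m) :
    R.coord ⟨m, v⟩ / σ m = (g.inner m v (R.vec m (σ m)) : ℂ) +
      (g.inner m v (R.vec m (Complex.I * σ m)) : ℂ) * Complex.I := by
  rw [(R.coord_eq_mul (R.isPosFrame_vec m (h.norm_eq m hm))).1, R.coord_vec,
    mul_div_cancel_left₀ _ (h.ne_zero hm)]
  exact (Complex.re_add_im _).symm

variable {E' H P : Type*} [NormedAddCommGroup E'] [NormedSpace ℝ E'] [TopologicalSpace H]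
  {J : ModelWithCorners ℝ E' H} [TopologicalSpace P] [ChartedSpace H P]

theorem IsGauge.contMDiffOn_coord_div {U : Set φ.Mcheck} {σ : φ.Mcheck → ℂ} (h : R.IsGauge U σ)
    {O : Set P} {F : P → TangentBundle (𝓡 3) φ.Mcheck} (hF : ContMDiffOn J (𝓡 3).tangent ∞ F O)
    (hFU : ∀ x ∈ O, (F x).proj ∈ U) :
    ContMDiffOn J 𝓘(ℝ, ℂ) ∞ (fun x => R.coord (F x) / σ (F x).proj) O := by
  have hq : ContMDiffOn J (𝓡 3) ∞ (fun x => (F x).proj) O :=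
    (contMDiff_proj (TangentSpace (𝓡 3) : φ.Mcheck → Type _)).comp_contMDiffOn hF
  have h1 : ContMDiffOn J 𝓘(ℝ, ℝ) ∞
      (fun x => g.inner (F x).proj (F x).snd (R.vec _ (σ (F x).proj))) O :=
    contMDiffOn_inner (q := fun x => (F x).proj) (v := fun x => (F x).snd) hF
      (ContMDiffOn.comp h.smooth hq hFU)
  have h2 : ContMDiffOn J 𝓘(ℝ, ℝ) ∞
      (fun x => g.inner (F x).proj (F x).snd (R.vec _ (Complex.I * σ (F x).proj))) O :=
    contMDiffOn_inner (q := fun x => (F x).proj) (v := fun x => (F x).snd) hF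
      (ContMDiffOn.comp h.smooth_I hq hFU)
  have h3 : ContDiff ℝ ∞ fun y : ℝ × ℝ => (y.1 : ℂ) + (y.2 : ℂ) * Complex.I :=
    (Complex.ofRealCLM.contDiff.comp contDiff_fst).add
      ((Complex.ofRealCLM.contDiff.comp contDiff_snd).mul contDiff_const)
  exact (h3.contMDiff.comp_contMDiffOn (h1.prodMk_space h2)).congr fun x hx =>
    h.coord_div (hFU x hx) _

theorem IsGauge.continuousOn_coord_div {U : Set φ.Mcheck} {σ : φ.Mcheck → ℂ} (h : R.IsGauge U σ)
    {Y : Type*} [TopologicalSpace Y]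
    {O : Set Y} {F : Y → TangentBundle (𝓡 3) φ.Mcheck} (hF : ContinuousOn F O)
    (hFU : ∀ x ∈ O, (F x).proj ∈ U) :
    ContinuousOn (fun x => R.coord (F x) / σ (F x).proj) O := by
  have hq : ContinuousOn (fun x => (F x).proj) O :=
    (FiberBundle.continuous_proj E3 (TangentSpace (𝓡 3) : φ.Mcheck → Type _)).comp_continuousOn hF
  have h1 : ContinuousOn
      (fun x => g.inner (F x).proj (F x).snd (R.vec _ (σ (F x).proj))) O :=
    continuousOn_inner (q := fun x => (F x).proj) (v := fun x => (F x).snd) hF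
      (ContinuousOn.comp (ContMDiffOn.continuousOn h.smooth) hq hFU)
  have h2 : ContinuousOn
      (fun x => g.inner (F x).proj (F x).snd (R.vec _ (Complex.I * σ (F x).proj))) O :=
    continuousOn_inner (q := fun x => (F x).proj) (v := fun x => (F x).snd) hF
      (ContinuousOn.comp (ContMDiffOn.continuousOn h.smooth_I) hq hFU)
  exact ((Complex.continuous_ofReal.comp_continuousOn h1).add
    ((Complex.continuous_ofReal.comp_continuousOn h2).mul continuousOn_const)).congr fun x hx =>
    h.coord_div (hFU x hx) _

theorem IsGauge.contMDiffOn_vec {U : Set φ.Mcheck} {σ : φ.Mcheck → ℂ} (h : R.IsGauge U σ)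
    {O : Set P} {q : P → φ.Mcheck} {c : P → ℂ} (hq : ContMDiffOn J (𝓡 3) ∞ q O)
    (hqU : Set.MapsTo q O U) (hc : ContMDiffOn J 𝓘(ℝ, ℂ) ∞ c O) :
    ContMDiffOn J (𝓡 3).tangent ∞
      (fun x => (⟨q x, R.vec (q x) (c x * σ (q x))⟩ : TangentBundle (𝓡 3) φ.Mcheck)) O := by
  have hre : ContMDiffOn J 𝓘(ℝ, ℝ) ∞ (fun x => (c x).re) O :=
    Complex.reCLM.contMDiff.comp_contMDiffOn hc
  have him : ContMDiffOn J 𝓘(ℝ, ℝ) ∞ (fun x => (c x).im) O :=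
    Complex.imCLM.contMDiff.comp_contMDiffOn hc
  refine (contMDiffOn_combination (q := q) (ContMDiffOn.comp h.smooth hq hqU)
    (ContMDiffOn.comp h.smooth_I hq hqU) hre him).congr fun x _ => ?_
  congr 1
  simp only [vec, Complex.mul_re, Complex.mul_im, Complex.I_re, Complex.I_im]
  module

theorem isGauge_of_smooth (hXs : IsSmoothField X Set.univ) {U : Set φ.Mcheck} (hU : IsOpen U)
    {σ : φ.Mcheck → ℂ} (hσ : ∀ m ∈ U, ‖σ m‖ = 1)
    (hs : IsSmoothField (fun m => R.vec m (σ m)) U) : R.IsGauge U σ := by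
  refine ⟨hσ, hs, fun m₀ hm₀ => ?_⟩
  obtain ⟨V, hV, hm₀V, ς, hς⟩ := exists_isGauge (R := R) hXs m₀
  have h1 : ContMDiffOn (𝓡 3) 𝓘(ℝ, ℂ) ∞ (fun m => σ m / ς m) (U ∩ V) :=
    (hς.contMDiffOn_coord_div (ContMDiffOn.mono hs Set.inter_subset_left)
      fun m hm => hm.2).congr fun m _ => by rw [R.coord_vec]
  have h2 : ContMDiffOn (𝓡 3) 𝓘(ℝ, ℂ) ∞ (fun m => Complex.I * (σ m / ς m)) (U ∩ V) :=
    (contDiff_const.mul contDiff_id :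
      ContDiff ℝ ∞ fun z : ℂ => Complex.I * z).contMDiff.comp_contMDiffOn h1
  have h3 := (hς.contMDiffOn_vec (q := fun m => m) contMDiffOn_id
    (fun m hm => hm.2) h2).congr (f₁ := fun m =>
      (⟨m, R.vec m (Complex.I * σ m)⟩ : TangentBundle (𝓡 3) φ.Mcheck)) fun m hm => by
    rw [mul_assoc, div_mul_cancel₀ _ (hς.ne_zero hm.2)]
  exact ((h3 m₀ ⟨hm₀, hm₀V⟩).contMDiffAt ((hU.inter hV).mem_nhds ⟨hm₀, hm₀V⟩)).contMDiffWithinAt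

theorem IsGauge.contMDiffOn_div {U V : Set φ.Mcheck} {σ ς : φ.Mcheck → ℂ} (h : R.IsGauge U σ)
    (h' : R.IsGauge V ς) : ContMDiffOn (𝓡 3) 𝓘(ℝ, ℂ) ∞ (fun m => σ m / ς m) (U ∩ V) :=
  (h'.contMDiffOn_coord_div (ContMDiffOn.mono h.smooth Set.inter_subset_left)
      fun m hm => hm.2).congr fun m _ => by rw [R.coord_vec]

/-- A map to `UX^⊥_p` is smooth if it is so in local gauges. -/
theorem isSmooth_of_gauge (hp : 0 < p) {f : P → φ.UPerpMod g X p}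
    (h : ∀ x₀, ∃ O : Set P, IsOpen O ∧ x₀ ∈ O ∧ ∃ (U : Set φ.Mcheck) (σ : φ.Mcheck → ℂ)
      (q : P → φ.Mcheck) (c : P → ℂ), R.IsGauge U σ ∧ ContMDiffOn J (𝓡 3) ∞ q O ∧
      Set.MapsTo q O U ∧ ContMDiffOn J 𝓘(ℝ, ℂ) ∞ c O ∧ ∀ x ∈ O, ‖c x‖ = 1 ∧
        (f x).base = q x ∧ R.coordMod hp (f x) = (c x * σ (q x)) ^ p) :
    UPerpMod.IsSmooth J f := by
  intro x₀
  obtain ⟨O, hO, hx₀, U, σ, q, c, hσ, hq, hqU, hc, hf⟩ := h x₀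
  refine ⟨O, hO, hx₀, _, hσ.contMDiffOn_vec hq hqU hc, fun x hx => ?_⟩
  obtain ⟨h1, h2, h3⟩ := hf x hx
  have hn : ‖c x * σ (q x)‖ = 1 := by rw [norm_mul, h1, hσ.norm_eq _ (hqU hx), one_mul]
  refine ⟨R.ofCoord (q x) _ hn, rfl, R.ext_coordMod hp h2 ?_⟩
  rw [h3, coordMod_mk, coord_ofCoord]

/-- A smooth section of `UX^⊥_p` locally is the image of a smooth section of `UX^⊥`. -/
theorem exists_gauge_of_isSmooth (hXs : IsSmoothField X Set.univ) (hp : 0 < p)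
    {ν : φ.Mcheck → φ.UPerpMod g X p}
    (hb : ∀ m, (ν m).base = m) (hν : UPerpMod.IsSmooth (𝓡 3) ν) (m₀ : φ.Mcheck) :
    ∃ U, IsOpen U ∧ m₀ ∈ U ∧ ∃ σ, R.IsGauge U σ ∧ ∀ m ∈ U, R.coordMod hp (ν m) = σ m ^ p := by
  obtain ⟨U, hU, hm₀, F, hF, h⟩ := hν m₀
  have hkey : ∀ m ∈ U, ∃ u : φ.UPerp g X, u.1 = F m ∧ u.base = m ∧ ν m = UPerpMod.mk u := by
    intro m hm
    obtain ⟨u, hu, hu'⟩ := h m hm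
    refine ⟨u, hu, ?_, hu'⟩
    rw [← hb m, hu']
    rfl
  refine ⟨U, hU, hm₀, fun m => R.coord (F m), isGauge_of_smooth hXs hU ?_ ?_, ?_⟩
  · intro m hm
    obtain ⟨u, hu, -, -⟩ := hkey m hm
    rw [← hu, R.norm_coord]
  · refine ContMDiffOn.congr hF fun m hm => ?_
    obtain ⟨u, hu, hub, -⟩ := hkey m hm
    have := R.eq_vec u
    rw [hub, hu] at this
    exact this.symm
  · intro m hm
    obtain ⟨u, hu, -, hu'⟩ := hkey m hm
    rw [hu', coordMod_mk, hu]

end RefFrame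

end ChartAtInfinity

namespace ChartAtInfinity

variable {M : Type u} [TopologicalSpace M] [ChartedSpace E3 M] [IsManifold (𝓡 3) ∞ M] [T2Space M]
  {o : ManifoldOrientation M} (φ : ChartAtInfinity o)

/-! ### The standard section near infinity -/

/-- The part of `M ∖ {∞}` in the domain of the chart at infinity. -/
def sourceCheck : Set φ.Mcheck := {m | (m : M) ∈ φ.chart.source}

theorem isOpen_sourceCheck : IsOpen φ.sourceCheck :=
  φ.chart.open_source.preimage continuous_subtype_val

variable {φ}

theorem zero_mem_target : (0 : E3) ∈ φ.chart.target :=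
  φ.closedBall_subset (Metric.mem_closedBall_self zero_le_one)

theorem chart_ne_zero {m : φ.Mcheck} (hm : m ∈ φ.sourceCheck) : φ.chart m ≠ 0 := fun h => by
  apply m.2
  change (m : M) = φ.chart.symm 0
  rw [← h, φ.chart.left_inv hm]

theorem mem_Vcheck_iff {m : φ.Mcheck} :
    m ∈ φ.Vcheck ↔ m ∈ φ.sourceCheck ∧ ‖φ.chart m‖ ≤ 1 := by
  constructor
  · rintro ⟨y, hy, hym⟩
    have h1 := φ.closedBall_subset hy
    refine ⟨?_, ?_⟩
    · change (m : M) ∈ φ.chart.source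
      rw [← hym]
      exact φ.chart.map_target h1
    · rw [← hym, φ.chart.right_inv h1]
      simpa using hy
  · rintro ⟨h1, h2⟩
    exact ⟨φ.chart m, by simpa using h2, φ.chart.left_inv h1⟩

theorem contMDiffOn_chart_val :
    ContMDiffOn (𝓡 3) (𝓡 3) ∞ (fun m : φ.Mcheck => φ.chart m) φ.sourceCheck :=
  (contMDiffOn_of_mem_maximalAtlas φ.mem_maximalAtlas).comp
    (contMDiff_subtype_val (n := ∞)).contMDiffOn fun _ hm => hm

theorem mfderiv_chart_val_bijective {m : φ.Mcheck} (hm : m ∈ φ.sourceCheck) :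
    Function.Bijective (mfderiv (𝓡 3) (𝓡 3) (fun m : φ.Mcheck => φ.chart m) m) := by
  have hd : φ.chart.MDifferentiable (𝓡 3) (𝓡 3) :=
    ⟨(contMDiffOn_of_mem_maximalAtlas φ.mem_maximalAtlas).mdifferentiableOn (by simp),
      (contMDiffOn_symm_of_mem_maximalAtlas φ.mem_maximalAtlas).mdifferentiableOn (by simp)⟩
  have h1 : mfderiv (𝓡 3) (𝓡 3) (fun m : φ.Mcheck => φ.chart m) m =
      (mfderiv (𝓡 3) (𝓡 3) φ.chart (m : M)).comp
        (mfderiv (𝓡 3) (𝓡 3) (Subtype.val : φ.Mcheck → M) m) :=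
    mfderiv_comp (I' := 𝓡 3) m (hd.mdifferentiableAt hm)
      ((contMDiff_subtype_val (n := ∞)).mdifferentiable (by simp) m)
  rw [h1]
  exact (hd.mfderiv_bijective hm).comp (mfderiv_val_bijective φ.infty m)

theorem contMDiffOn_coord : ContMDiffOn (𝓡 3) (𝓡 3) ∞ φ.coord φ.sourceCheck := by
  intro m hm
  have h : ContDiffAt ℝ ∞ (EuclideanGeometry.inversion (0 : E3) 1) (φ.chart m) :=
    contDiffAt_const.inversion contDiffAt_const contDiffAt_id (chart_ne_zero hm)
  exact h.contMDiffAt.comp_contMDiffWithinAt m (contMDiffOn_chart_val m hm)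

theorem exists_hasFDerivAt_inversion {y : E3} (hy : y ≠ 0) :
    ∃ D : E3 →L[ℝ] E3, HasFDerivAt (EuclideanGeometry.inversion (0 : E3) 1) D y ∧
      Function.Injective D := by
  refine ⟨_, EuclideanGeometry.hasFDerivAt_inversion hy, fun v w hvw => ?_⟩
  have hne : (1 / dist y 0) ^ 2 ≠ 0 :=
    pow_ne_zero _ (div_ne_zero one_ne_zero (dist_ne_zero.2 hy))
  simpa [hne, hy] using hvw

theorem isInvertible_of_injective {D : E3 →L[ℝ] E3} (hD : Function.Injective D) :
    D.IsInvertible :=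
  ⟨(LinearEquiv.ofInjectiveEndo D.toLinearMap hD).toContinuousLinearEquiv, by ext v; rfl⟩

theorem mfderiv_coord_isInvertible {m : φ.Mcheck} (hm : m ∈ φ.sourceCheck) :
    (mfderiv (𝓡 3) (𝓡 3) φ.coord m).IsInvertible := by
  obtain ⟨D, hD, hDi⟩ := exists_hasFDerivAt_inversion (chart_ne_zero hm)
  have h1 : MDifferentiableAt (𝓡 3) (𝓡 3) (fun m : φ.Mcheck => φ.chart m) m :=
    (contMDiffOn_chart_val.contMDiffAt (φ.isOpen_sourceCheck.mem_nhds hm)).mdifferentiableAt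
      (by simp)
  have h2 : mfderiv (𝓡 3) (𝓡 3) φ.coord m = D.comp _ :=
    (hD.hasMFDerivAt.comp m h1.hasMFDerivAt).mfderiv
  have h3 : Function.Injective (mfderiv (𝓡 3) (𝓡 3) φ.coord m) := by
    intro v w hvw
    rw [h2] at hvw
    exact (mfderiv_chart_val_bijective hm).1 (hDi hvw)
  exact isInvertible_of_injective h3

variable (φ) in
/-- The tangent vector at `m` of coordinates `(1,0,0)`, over the domain of the chart at infinity. -/
def stdField (m : φ.Mcheck) : TangentSpace (𝓡 3) m :=
  VectorField.mpullback (𝓡 3) (𝓡 3) φ.coord (fun y : E3 => (stdVec 0 : TangentSpace (𝓡 3) y)) m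

theorem dcoord_stdField {m : φ.Mcheck} (hm : m ∈ φ.sourceCheck) :
    φ.dcoord m (φ.stdField m) = stdVec 0 :=
  (mfderiv_coord_isInvertible hm).self_apply_inverse _

theorem isSmoothField_stdField : IsSmoothField φ.stdField φ.sourceCheck := by
  intro m hm
  refine ContMDiffAt.contMDiffWithinAt ?_
  refine ContMDiffAt.mpullback_vectorField_preimage (n := ∞) ?_
    (contMDiffOn_coord.contMDiffAt (φ.isOpen_sourceCheck.mem_nhds hm))
    (mfderiv_coord_isInvertible hm) (by simp)
  have h : ContMDiff (𝓡 3) (𝓡 3).tangent ∞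
      (fun y : E3 => (⟨y, stdVec 0⟩ : TangentBundle (𝓡 3) E3)) :=
    contMDiff_vectorSpace_iff_contDiff.2 contDiff_const
  exact h _

/-- The punctured ball of radius `r` around infinity; it is slightly larger than `V ∖ {∞}` when `r` is
slightly larger than `1`. -/
def ballCheck (φ : ChartAtInfinity o) (r : ℝ) : Set φ.Mcheck :=
  {m | m ∈ φ.sourceCheck ∧ ‖φ.chart m‖ < r}

theorem isOpen_ballCheck (r : ℝ) : IsOpen (φ.ballCheck r) :=
  (contMDiffOn_chart_val.continuousOn.norm).isOpen_inter_preimage φ.isOpen_sourceCheck isOpen_Iio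

theorem Vcheck_subset_ballCheck {r : ℝ} (hr : 1 < r) : φ.Vcheck ⊆ φ.ballCheck r := fun _ hm =>
  ⟨(mem_Vcheck_iff.1 hm).1, (mem_Vcheck_iff.1 hm).2.trans_lt hr⟩

/-- Open subsets of `M ∖ {∞}` that contain `V ∖ {∞}` contain a larger punctured ball. -/
theorem exists_ballCheck_subset {O : Set φ.Mcheck} (hO : IsOpen O) (hV : φ.Vcheck ⊆ O) :
    ∃ r, 1 < r ∧ Metric.ball 0 r ⊆ φ.chart.target ∧ φ.ballCheck r ⊆ O := by
  have hO' : IsOpen (Subtype.val '' O ∪ φ.chart.symm '' Metric.ball 0 1 : Set M) := by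
    refine (φ.Mcheck.isOpen.isOpenMap_subtype_val _ hO).union ?_
    exact φ.chart.symm.isOpen_image_of_subset_source Metric.isOpen_ball
      (Metric.ball_subset_closedBall.trans φ.closedBall_subset)
  have h1 := φ.chart.symm.isOpen_inter_preimage hO'
  obtain ⟨δ, hδ, hδ'⟩ := (isCompact_closedBall (0 : E3) 1).exists_thickening_subset_open h1 (by
    intro y hy
    refine ⟨φ.closedBall_subset hy, ?_⟩
    by_cases h0 : y = 0
    · exact Or.inr ⟨y, by simp [h0], rfl⟩
    · refine Or.inl ⟨⟨φ.chart.symm y, fun h => h0 ?_⟩, hV ⟨y, hy, rfl⟩, rfl⟩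
      have h2 := congrArg φ.chart h
      rwa [infty, φ.chart.right_inv (φ.closedBall_subset hy), φ.chart.right_inv zero_mem_target]
        at h2)
  rw [thickening_closedBall hδ zero_le_one] at hδ'
  refine ⟨δ + 1, by linarith, fun y hy => (hδ' hy).1, fun m hm => ?_⟩
  rcases (hδ' (mem_ball_zero_iff.2 hm.2)).2 with h2 | h2
  · rw [φ.chart.left_inv hm.1] at h2
    obtain ⟨n, hn, hnm⟩ := h2
    rwa [← Subtype.ext hnm]
  · rw [φ.chart.left_inv hm.1] at h2
    exact hV (Set.image_mono Metric.ball_subset_closedBall h2)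

variable {g : φ.RiemMetric} {X : ∀ m : φ.Mcheck, TangentSpace (𝓡 3) m}

/-- The section `(1,0,0)` of `UX^⊥` over `V ∖ {∞}` extends to a smooth section over a larger
punctured ball. -/
theorem RefFrame.exists_standard_gauge (R : φ.RefFrame g X) (hg : φ.IsStandardMetric g)
    (hX : φ.IsCombing g X) : ∃ r, 1 < r ∧ Metric.ball 0 r ⊆ φ.chart.target ∧
      ∃ σ, R.IsGauge (φ.ballCheck r) σ ∧ ∀ m ∈ φ.Vcheck, φ.dcoord m (R.vec m (σ m)) = stdVec 0 := by
  have hXs : IsSmoothField X Set.univ := hX.smooth.contMDiffOn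
  have hb : IsSmoothField (orthoPart g X φ.stdField) φ.sourceCheck :=
    isSmoothField_stdField.orthoPart (ContMDiffOn.mono hXs (Set.subset_univ _))
  have hV1 : ∀ m ∈ φ.Vcheck, orthoPart g X φ.stdField m = φ.stdField m := fun m hm => by
    refine orthoPart_eq_self ?_
    rw [hg m hm, dcoord_stdField (mem_Vcheck_iff.1 hm).1, hX.standard m hm]
    simp [stdVec, EuclideanSpace.inner_single_left]
  have hV2 : ∀ m ∈ φ.Vcheck,
      g.inner m (orthoPart g X φ.stdField m) (orthoPart g X φ.stdField m) = 1 := fun m hm => by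
    rw [hV1 m hm, hg m hm, dcoord_stdField (mem_Vcheck_iff.1 hm).1]
    simp [stdVec]
  obtain ⟨r, hr, hrt, hrO⟩ := exists_ballCheck_subset
    (isOpen_inter_pos (g := g) φ.isOpen_sourceCheck hb)
    fun m hm => ⟨(mem_Vcheck_iff.1 hm).1, by simp [hV2 m hm]⟩
  set e := normalized g (orthoPart g X φ.stdField) with he
  have hes : IsSmoothField e (φ.ballCheck r) :=
    IsSmoothField.normalized (ContMDiffOn.mono hb fun m hm => hm.1) fun m hm => (hrO hm).2
  have hvec : ∀ m, R.vec m (R.coord ⟨m, e m⟩) = e m := fun m =>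
    R.vec_coord (inner_normalized_of_orthogonal (inner_orthoPart_self (hX.unit m)))
  refine ⟨r, hr, hrt, fun m => R.coord ⟨m, e m⟩, isGauge_of_smooth hXs (isOpen_ballCheck r) ?_ ?_, ?_⟩
  · intro m hm
    exact R.norm_coord ⟨⟨m, e m⟩, inner_normalized_self (hrO hm).2,
      inner_normalized_of_orthogonal (inner_orthoPart_self (hX.unit m))⟩
  · exact ContMDiffOn.congr hes fun m _ => by simp only [hvec]
  · intro m hm
    rw [hvec, he, normalized_eq_self (hV2 m hm), hV1 m hm,
      dcoord_stdField (mem_Vcheck_iff.1 hm).1]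

theorem dcoord_injective {m : φ.Mcheck} (hm : m ∈ φ.Vcheck) :
    Function.Injective (φ.dcoord m) := by
  have h := mfderiv_coord_isInvertible (mem_Vcheck_iff.1 hm).1
  exact h.injective

/-- The behaviour of multisections near infinity, in terms of coordinates. -/
theorem RefFrame.isStandard_iff (R : φ.RefFrame g X) {p : ℕ}
    (hp : 0 < p) {m : φ.Mcheck} (hm : m ∈ φ.Vcheck) {c : ℂ} (hc : ‖c‖ = 1)
    (hcs : φ.dcoord m (R.vec m c) = stdVec 0) {x : φ.UPerpMod g X p} :
    (∃ e : φ.UPerp g X, e.base = m ∧ φ.dcoord e.1.proj e.1.snd = stdVec 0 ∧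
      x = UPerpMod.mk e) ↔ x.base = m ∧ R.coordMod hp x = c ^ p := by
  constructor
  · rintro ⟨⟨⟨m', v⟩, hv⟩, rfl, he, rfl⟩
    refine ⟨rfl, ?_⟩
    change φ.dcoord m' v = _ at he
    have hinj := dcoord_injective hm
    obtain rfl : R.vec m' c = v := hinj (hcs.trans he.symm)
    rw [coordMod_mk, R.coord_vec]
  · rintro ⟨h1, h2⟩
    refine ⟨R.ofCoord m c hc, rfl, hcs, R.ext_coordMod hp h1 ?_⟩
    rw [h2, coordMod_mk, coord_ofCoord]

end ChartAtInfinity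

/-! ### Homotopies between multisections -/

open SingularCohomology in
/-- On a space with no rational homology in degree one, circle-valued functions have logarithms. -/
theorem exists_turn_eq_of_isZero_rationalHomology {M : Type u} [TopologicalSpace M]
    (hM : CategoryTheory.Limits.IsZero (rationalHomology M 1)) {f : M → ℂ} (hf : Continuous f)
    (hf1 : ∀ m, ‖f m‖ = 1) :
    ∃ h : M → ℝ, (∀ m, turn (h m) = f m) ∧ ∀ γ : Simplex M 1,
      h (γ (stdSimplex.vertex 1)) - h (γ (stdSimplex.vertex 0)) = variation fun t => f (γ t) := by
  obtain ⟨h, hh⟩ := exists_potential_of_isZero_rationalHomology hM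
    (fun γ => variation fun t => f (γ t)) fun σ => by
      have h1 := sum_variation_faceMap (f := fun x => f (σ x)) (by fun_prop) fun x => hf1 _
      simp only [Fin.sum_univ_three] at h1
      norm_num at h1
      rw [sub_eq_add_neg]
      exact h1
  -- The defect of `h` is constant along paths, and so is any choice of a logarithm of it.
  have hd : ∀ m, ‖f m / turn (h m)‖ = 1 := fun m => by rw [norm_div, hf1, norm_turn, div_one]
  let a : ℂ → ℝ := fun z => Classical.epsilon fun b => turn b = z
  have ha : ∀ {z : ℂ}, ‖z‖ = 1 → turn (a z) = z := fun hz =>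
    Classical.epsilon_spec (p := fun b => turn b = _) (exists_turn_eq hz)
  refine ⟨fun m => h m + a (f m / turn (h m)), fun m => ?_, fun γ => ?_⟩
  · rw [turn_add, ha (hd m), mul_div_cancel₀ _ (turn_ne_zero _)]
  · have h1 := turn_variation (f := fun t => f (γ t)) (by fun_prop) fun t => hf1 _
    have h0 : ∀ m, f m ≠ 0 := fun m h0 => by simpa [h0] using hf1 m
    rw [hh γ, turn_sub, div_eq_div_iff (turn_ne_zero _) (h0 _)] at h1
    have h2 : f (γ (stdSimplex.vertex 1)) / turn (h (γ (stdSimplex.vertex 1))) =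
        f (γ (stdSimplex.vertex 0)) / turn (h (γ (stdSimplex.vertex 0))) := by
      rw [div_eq_div_iff (turn_ne_zero _) (turn_ne_zero _), ← h1, mul_comm]
    simp only [h2, hh γ]
    ring

namespace ChartAtInfinity

variable {M : Type u} [TopologicalSpace M] [ChartedSpace E3 M] [IsManifold (𝓡 3) ∞ M] [T2Space M]
  {o : ManifoldOrientation M} {φ : ChartAtInfinity o}

/-- If `M` has no rational homology in degree one, a smooth circle-valued function on `M ∖ {∞}`
that is trivial near infinity has a smooth logarithm that vanishes near infinity. -/
theorem exists_smooth_turn_eq (hM : CategoryTheory.Limits.IsZero (rationalHomology M 1))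
    {f : φ.Mcheck → ℂ} (hf : ContMDiff (𝓡 3) 𝓘(ℝ, ℂ) ∞ f) (hf1 : ∀ m, ‖f m‖ = 1)
    (hfV : ∀ m ∈ φ.Vcheck, f m = 1) :
    ∃ h : φ.Mcheck → ℝ, ContMDiff (𝓡 3) 𝓘(ℝ, ℝ) ∞ h ∧ (∀ m, turn (h m) = f m) ∧
      ∀ m ∈ φ.Vcheck, h m = 0 := by
  classical
  let F : M → ℂ := fun m => if hm : m ∈ φ.Mcheck then f ⟨m, hm⟩ else 1
  have hF : ∀ m : φ.Mcheck, F m = f m := fun m => dif_pos m.2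
  have hF1 : ∀ m, ‖F m‖ = 1 := fun m => by
    by_cases hm : m ∈ φ.Mcheck
    · exact (congrArg norm (hF ⟨m, hm⟩)).trans (hf1 _)
    · simp only [F, dif_neg hm, norm_one]
  have hFV : ∀ y ∈ Metric.closedBall (0 : E3) 1, F (φ.chart.symm y) = 1 := fun y hy => by
    by_cases hm : φ.chart.symm y ∈ φ.Mcheck
    · exact (hF ⟨_, hm⟩).trans (hfV _ ⟨y, hy, rfl⟩)
    · simp only [F, dif_neg hm]
  have hFc : Continuous F := by
    rw [continuous_iff_continuousAt]
    intro m
    by_cases hm : m ∈ φ.Mcheck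
    · have h1 : ContinuousAt (F ∘ Subtype.val) (⟨m, hm⟩ : φ.Mcheck) := by
        have : F ∘ Subtype.val = f := funext hF
        rw [this]
        exact hf.continuous.continuousAt
      exact φ.Mcheck.isOpen.isOpenEmbedding_subtypeVal.continuousAt_iff.1 h1
    · have hm' : m = φ.chart.symm 0 := not_not.1 hm
      have h1 : φ.chart.symm '' Metric.ball 0 1 ∈ 𝓝 m := by
        refine (φ.chart.symm.isOpen_image_of_subset_source Metric.isOpen_ball
          (Metric.ball_subset_closedBall.trans φ.closedBall_subset)).mem_nhds ?_
        exact ⟨0, by simp, hm'.symm⟩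
      refine (continuousAt_const (y := (1 : ℂ))).congr (Filter.eventually_of_mem h1 ?_)
      rintro _ ⟨y, hy, rfl⟩
      exact (hFV y (Metric.ball_subset_closedBall hy)).symm
  obtain ⟨h, hh, hγ⟩ := exists_turn_eq_of_isZero_rationalHomology hM hFc hF1
  refine ⟨fun m => h m - h (φ.chart.symm 0), ?_, fun m => ?_, ?_⟩
  · rw [← contMDiffOn_univ]
    refine contMDiffOn_of_variation isOpen_univ hf.contMDiffOn (fun m _ => hf1 m) fun γ _ => ?_
    have h1 := hγ ((⟨Subtype.val, continuous_subtype_val⟩ : C(φ.Mcheck, M)).comp γ)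
    simp only [ContinuousMap.comp_apply, ContinuousMap.coe_mk, hF] at h1
    rw [← h1]
    ring
  · rw [turn_sub, hh, hh, hF, hFV 0 (by simp), div_one]
  · rintro m ⟨y, hy, hym⟩
    have hmem : ∀ t : unitInterval, (t : ℝ) • y ∈ Metric.closedBall (0 : E3) 1 := fun t => by
      rw [mem_closedBall_zero_iff] at hy ⊢
      rw [norm_smul, Real.norm_of_nonneg t.2.1]
      exact mul_le_one₀ t.2.2 (norm_nonneg _) hy
    -- The radius from infinity to `m`, along which the function is trivial.
    let P : Path (φ.chart.symm 0) (m : M) :=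
      { toFun := fun t => φ.chart.symm ((t : ℝ) • y)
        continuous_toFun := φ.chart.symm.continuousOn.comp_continuous (by fun_prop)
          fun t => φ.closedBall_subset (hmem t)
        source' := by simp
        target' := by simp [hym] }
    have h1 := hγ (pathSimplex P)
    rw [variation_const (f := fun t => F (pathSimplex P t)) (z := 1) (by simp)
      fun t => hFV _ (hmem _)] at h1
    simpa using h1

variable {g : φ.RiemMetric} {X : ∀ m : φ.Mcheck, TangentSpace (𝓡 3) m}

theorem RefFrame.contMDiff_coordMod_div (R : φ.RefFrame g X) (hXs : IsSmoothField X Set.univ)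
    {p : ℕ} (hp : 0 < p) {ν ν' : φ.Mcheck → φ.UPerpMod g X p}
    (hν : φ.IsMultisection g X p ν) (hν' : φ.IsMultisection g X p ν') :
    ContMDiff (𝓡 3) 𝓘(ℝ, ℂ) ∞ fun m => R.coordMod hp (ν' m) / R.coordMod hp (ν m) := by
  intro m
  obtain ⟨U, hU, hmU, σ, hσ, h⟩ := exists_gauge_of_isSmooth (R := R) hXs hp hν.base_eq hν.smooth m
  obtain ⟨U', hU', hmU', σ', hσ', h'⟩ :=
    exists_gauge_of_isSmooth (R := R) hXs hp hν'.base_eq hν'.smooth m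
  have h1 : ContMDiffOn (𝓡 3) 𝓘(ℝ, ℂ) ∞ (fun m => (σ' m / σ m) ^ p) (U' ∩ U) :=
    (contDiff_id.pow p : ContDiff ℝ ∞ fun z : ℂ => z ^ p).contMDiff.comp_contMDiffOn
      (hσ'.contMDiffOn_div hσ)
  refine (h1.congr fun x hx => ?_).contMDiffAt ((hU'.inter hU).mem_nhds ⟨hmU', hmU⟩)
  rw [h x hx.2, h' x hx.1, div_pow]

theorem exists_homotopy_of_multisections
    (hM : CategoryTheory.Limits.IsZero (rationalHomology M 1)) (hg : φ.IsStandardMetric g)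
    (hX : φ.IsCombing g X) {p : ℕ} (hp : 0 < p) {ν ν' : φ.Mcheck → φ.UPerpMod g X p}
    (hν : φ.IsMultisection g X p ν) (hν' : φ.IsMultisection g X p ν') :
    ∃ H : unitInterval × φ.Mcheck → φ.UPerpMod g X p,
      φ.IsHomotopyOfMultisections g X p ν ν' H := by
  obtain ⟨R⟩ := exists_refFrame (o := o) hX.unit
  have hXs : IsSmoothField X Set.univ := hX.smooth.contMDiffOn
  obtain ⟨r, hr, -, ς, hς, hςs⟩ := R.exists_standard_gauge hg hX
  have hstd : ∀ {m}, m ∈ φ.Vcheck → ∀ {x : φ.UPerpMod g X p}, _ ↔ _ := fun {m} hm {x} =>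
    R.isStandard_iff hp hm (hς.norm_eq m (Vcheck_subset_ballCheck hr hm)) (hςs m hm) (x := x)
  have hp' : (p : ℝ) ≠ 0 := by exact_mod_cast hp.ne'
  obtain ⟨h, hs, hturn, hV⟩ := exists_smooth_turn_eq hM
    (R.contMDiff_coordMod_div hXs hp hν hν')
    (fun m => by rw [norm_div, R.norm_coordMod, R.norm_coordMod, div_one])
    fun m hm => by
      rw [((hstd hm).1 (hν.standard m hm)).2, ((hstd hm).1 (hν'.standard m hm)).2]
      exact div_self (pow_ne_zero _ (hς.ne_zero (Vcheck_subset_ballCheck hr hm)))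
  have hex : ∀ x : unitInterval × φ.Mcheck, ∃ y : φ.UPerpMod g X p, y.base = x.2 ∧
      R.coordMod hp y = turn (x.1 * h x.2) * R.coordMod hp (ν x.2) := fun x =>
    R.exists_coordMod hp x.2 (by rw [norm_mul, norm_turn, R.norm_coordMod, one_mul])
  choose H hHb hHc using hex
  -- Smoothness of a family of sections obtained by rotating `ν`.
  have hsmooth : ∀ {E' H' P : Type _} [NormedAddCommGroup E'] [NormedSpace ℝ E']
      [TopologicalSpace H'] [TopologicalSpace P] [ChartedSpace H' P] (J : ModelWithCorners ℝ E' H')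
      (k : P → unitInterval × φ.Mcheck), ContMDiff J 𝓘(ℝ, ℝ) ∞ (fun x => ((k x).1 : ℝ)) →
      ContMDiff J (𝓡 3) ∞ (fun x => (k x).2) → UPerpMod.IsSmooth J fun x => H (k x) := by
    intro E' H' P _ _ _ _ _ J k hk1 hk2
    refine RefFrame.isSmooth_of_gauge (R := R) hp fun x₀ => ?_
    obtain ⟨U, hU, hmU, σ, hσ, h1⟩ :=
      RefFrame.exists_gauge_of_isSmooth (R := R) hXs hp hν.base_eq hν.smooth (k x₀).2
    refine ⟨(fun x => (k x).2) ⁻¹' U, hU.preimage hk2.continuous, hmU, U, σ, fun x => (k x).2,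
      fun x => turn ((k x).1 * h (k x).2 / p), hσ, hk2.contMDiffOn, fun x hx => hx, ?_,
      fun x hx => ⟨norm_turn _, hHb _, ?_⟩⟩
    · have h2 : ContMDiff J 𝓘(ℝ, ℝ) ∞ fun x => h (k x).2 := hs.comp hk2
      have h3 : ContDiff ℝ ∞ fun y : ℝ × ℝ => turn (y.1 * y.2 / p) :=
        contDiff_turn.comp ((contDiff_fst.mul contDiff_snd).div_const _)
      exact (h3.contMDiff.comp (hk1.prodMk_space h2)).contMDiffOn
    · rw [hHc, h1 _ hx, mul_pow, ← turn_natCast_mul, mul_div_cancel₀ _ hp']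
  refine ⟨H, ?_, fun m => ?_, fun m => ?_, fun t => ⟨fun m => hHb _, ?_, fun m hm => ?_⟩⟩
  · exact hsmooth _ (fun x => x) (contMDiff_subtypeVal_Icc.comp contMDiff_fst) contMDiff_snd
  · refine R.ext_coordMod hp ?_ ?_
    · rw [hHb, hν.base_eq]
    · simp [hHc]
  · refine R.ext_coordMod hp ?_ ?_
    · rw [hHb, hν'.base_eq]
    · simp [hHc, hturn, R.coordMod_ne_zero]
  · exact hsmooth _ (fun m => (t, m)) (contMDiff_const (c := (t : ℝ))) contMDiff_id
  · refine (hstd hm).2 ⟨hHb _, ?_⟩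
    rw [hHc, hV m hm, mul_zero, turn_zero, one_mul, ((hstd hm).1 (hν.standard m hm)).2]

end ChartAtInfinity

namespace ChartAtInfinity

open SingularCohomology

variable {M : Type u} [TopologicalSpace M] [ChartedSpace E3 M] [IsManifold (𝓡 3) ∞ M] [T2Space M]
  {o : ManifoldOrientation M} {φ : ChartAtInfinity o} {g : φ.RiemMetric}
  {X : ∀ m : φ.Mcheck, TangentSpace (𝓡 3) m}

/-! ### Local potentials -/

variable (φ g X) in
/-- Lifts of the points and of the paths of `M ∖ {∞}` to `UX^⊥`, as in the definition of obstruction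
cochains, together with an integral cochain `b` whose coboundary is `p` times the obstruction
cochain of these lifts. -/
structure ObstructionPrimitive (p : ℕ) where
  s₀ : φ.Mcheck → φ.UPerp g X
  s₁ : Simplex φ.Mcheck 1 → Simplex (φ.UPerp g X) 1
  b : Cochain φ.Mcheck 1
  base_zero : ∀ m, (s₀ m).base = m
  base_one : ∀ γ t, (s₁ γ t).base = γ t
  vertex : ∀ γ (i : Fin 2), s₁ γ (stdSimplex.vertex i) = s₀ (γ (stdSimplex.vertex i))
  coboundary_eq : ∀ S : Simplex φ.Mcheck 2,
    ∃ (τ : Simplex (φ.UPerp g X) 2) (θ : Fin 3 → C(stdSimplex ℝ (Fin 2), ℝ)),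
      (∀ x, (τ x).base = S x) ∧
      (∀ i t, UPerp.Rotates (2 * Real.pi * θ i t) (τ (faceMap 1 i t)) (s₁ (face i S) t)) ∧
      ∑ i : Fin 3, (-1 : ℝ) ^ (i : ℕ) * b (face i S) = p * ∑ i : Fin 3,
        (-1 : ℝ) ^ (i : ℕ) * (θ i (stdSimplex.vertex 1) - θ i (stdSimplex.vertex 0))

theorem exists_obstructionPrimitive {e : SingularCohomology φ.Mcheck 2}
    (he : φ.IsEulerClass g X e) {p : ℕ} (hpe : addOrderOf e ∣ p) :
    Nonempty (φ.ObstructionPrimitive g X p) := by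
  obtain ⟨c, ⟨s₀, s₁, h₀, h₁, hv, hobs⟩, rfl⟩ := he
  have h0 : p • (QuotientAddGroup.mk c : SingularCohomology φ.Mcheck 2) = 0 :=
    addOrderOf_dvd_iff_nsmul_eq_zero.1 hpe
  have h2 : p • c ∈ (coboundaries φ.Mcheck 2).addSubgroupOf (cocycles φ.Mcheck 2) :=
    (QuotientAddGroup.eq_zero_iff (p • c)).1 h0
  obtain ⟨b, hb⟩ := AddSubgroup.mem_addSubgroupOf.1 h2
  refine ⟨⟨s₀, s₁, b, h₀, h₁, hv, fun S => ?_⟩⟩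
  obtain ⟨τ, θ, hτ, hθ, hc⟩ := hobs S
  refine ⟨τ, θ, hτ, hθ, ?_⟩
  rw [← hc]
  have h3 := congrArg (fun d : Cochain φ.Mcheck 2 => (d S : ℝ)) hb
  simpa [coboundary] using h3

namespace ObstructionPrimitive

variable {p : ℕ} (D : φ.ObstructionPrimitive g X p) (R : φ.RefFrame g X)

/-- `p` times the variation, along `γ`, of the lift of `γ` with respect to the section of
coordinate `σ`, corrected by the cochain `b`. -/
def period (σ : φ.Mcheck → ℂ) (γ : Simplex φ.Mcheck 1) : ℝ :=
  p * variation (fun t => R.coord (D.s₁ γ t).1 / σ (γ t)) - D.b γ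

/-- The function `h` on `U` has the variation of the periods in the gauge `σ`, and the corresponding
values in the circle. -/
structure IsPotential (U : Set φ.Mcheck) (σ : φ.Mcheck → ℂ) (h : φ.Mcheck → ℝ) : Prop where
  isGauge : R.IsGauge U σ
  turn_eq : ∀ m ∈ U, turn (h m) = (R.coord (D.s₀ m).1 / σ m) ^ p
  sub_eq : ∀ γ : Simplex φ.Mcheck 1, (∀ t, γ t ∈ U) →
    h (γ (stdSimplex.vertex 1)) - h (γ (stdSimplex.vertex 0)) = D.period R σ γ

variable {D R} {U : Set φ.Mcheck} {σ : φ.Mcheck → ℂ}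

theorem _root_.ChartAtInfinity.RefFrame.IsGauge.continuous_coord_div (hσ : R.IsGauge U σ) {n : ℕ}
    (τ : Simplex (φ.UPerp g X) n) (S : Simplex φ.Mcheck n) (hb : ∀ x, (τ x).base = S x)
    (hS : ∀ x, S x ∈ U) : Continuous fun x => R.coord (τ x).1 / σ (S x) := by
  rw [← continuousOn_univ]
  refine (hσ.continuousOn_coord_div (F := fun x => (τ x).1)
    (continuous_subtype_val.comp τ.continuous).continuousOn fun x _ => ?_).congr fun x _ => ?_
  · have h := hS x
    rw [← hb x] at h
    exact h
  · rw [← hb x]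
    rfl

theorem _root_.ChartAtInfinity.RefFrame.IsGauge.norm_coord_div (hσ : R.IsGauge U σ)
    (u : φ.UPerp g X) {m : φ.Mcheck} (hm : m ∈ U) : ‖R.coord u.1 / σ m‖ = 1 := by
  rw [norm_div, R.norm_coord, hσ.norm_eq m hm, div_one]

theorem sum_period_face (hσ : R.IsGauge U σ) (S : Simplex φ.Mcheck 2) (hS : ∀ x, S x ∈ U) :
    D.period R σ (face 0 S) - D.period R σ (face 1 S) + D.period R σ (face 2 S) = 0 := by
  obtain ⟨τ, θ, hτ, hθ, hb⟩ := D.coboundary_eq S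
  have hc := hσ.continuous_coord_div τ S hτ hS
  have h1 : ∀ i : Fin 3, variation (fun t => R.coord (D.s₁ (face i S) t).1 / σ (face i S t)) =
      (θ i (stdSimplex.vertex 1) - θ i (stdSimplex.vertex 0)) +
        variation fun t => R.coord (τ (faceMap 1 i t)).1 / σ (S (faceMap 1 i t)) := by
    intro i
    rw [← variation_eq_of_lift (f := fun t => turn (θ i t)) (θ i).continuous fun t => rfl,
      ← variation_mul (f := fun t => turn (θ i t))
      (g := fun t => R.coord (τ (faceMap 1 i t)).1 / σ (S (faceMap 1 i t)))
      (continuous_turn.comp (θ i).continuous) (fun t => norm_turn _)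
      (hc.comp (faceMap 1 i).continuous) fun t => hσ.norm_coord_div _ (hS _)]
    congr 1
    funext t
    rw [(R.rotates_iff.1 (hθ i t)).2, mul_div_assoc]
    rfl
  have h2 := sum_variation_faceMap hc fun x => hσ.norm_coord_div _ (hS _)
  simp only [period, h1]
  simp only [Fin.sum_univ_three] at h2 hb
  norm_num at h2 hb
  linear_combination (p : ℝ) * h2 - hb

theorem period_const (hσ : R.IsGauge U σ) {m : φ.Mcheck} (hm : m ∈ U)
    {γ : Simplex φ.Mcheck 1} (hγ : ∀ t, γ t = m) : D.period R σ γ = 0 := by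
  have h := sum_period_face (D := D) hσ (ContinuousMap.const _ m) fun _ => hm
  have h1 : ∀ i : Fin 3, face i (ContinuousMap.const _ m : Simplex φ.Mcheck 2) = γ := fun i => by
    ext1 t
    exact (hγ t).symm
  rw [h1, h1, h1] at h
  linarith

theorem turn_period (hσ : R.IsGauge U σ) {γ : Simplex φ.Mcheck 1} (hγ : ∀ t, γ t ∈ U) :
    turn (D.period R σ γ) =
      (R.coord (D.s₀ (γ (stdSimplex.vertex 1))).1 / σ (γ (stdSimplex.vertex 1))) ^ p /
        (R.coord (D.s₀ (γ (stdSimplex.vertex 0))).1 / σ (γ (stdSimplex.vertex 0))) ^ p := by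
  rw [period, turn_sub, turn_intCast, div_one, turn_natCast_mul,
    turn_variation (hσ.continuous_coord_div _ γ (D.base_one γ) hγ)
      fun t => hσ.norm_coord_div _ (hγ t), D.vertex, D.vertex, div_pow]

theorem _root_.stdSimplex.map_const {m n : ℕ} (j : Fin (n + 1)) (x : stdSimplex ℝ (Fin (m + 1))) :
    stdSimplex.map (fun _ => j) x = stdSimplex.vertex (S := ℝ) j := by
  have h : stdSimplex.map (fun _ => (0 : Fin 1)) x = stdSimplex.vertex (S := ℝ) (0 : Fin 1) :=
    Subsingleton.elim _ _
  have h2 := stdSimplex.map_comp_apply (S := ℝ) (fun _ : Fin (m + 1) => (0 : Fin 1))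
    (fun _ : Fin 1 => j) x
  rw [h, stdSimplex.map_vertex] at h2
  exact h2.symm

/-- The affine map from the `2`-simplex to the square `Δ¹ × Δ¹` that takes the vertex `i` to
`(a i, b i)`. -/
def triangle (a b : Fin 3 → Fin 2) :
    C(stdSimplex ℝ (Fin 3), stdSimplex ℝ (Fin 2) × stdSimplex ℝ (Fin 2)) :=
  ⟨fun x => (stdSimplex.map a x, stdSimplex.map b x),
    (stdSimplex.continuous_map a).prodMk (stdSimplex.continuous_map b)⟩

theorem triangle_faceMap (a b : Fin 3 → Fin 2) (i : Fin 3) (t : stdSimplex ℝ (Fin 2)) :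
    triangle a b (faceMap 1 i t) =
      (stdSimplex.map (a ∘ i.succAbove) t, stdSimplex.map (b ∘ i.succAbove) t) :=
  Prod.ext (stdSimplex.map_comp_apply _ _ _) (stdSimplex.map_comp_apply _ _ _)

/-- The periods of paths in a contracted set are the differences of the periods of the tracks of
their ends under the contraction: the square swept by the path is the union of two triangles. -/
theorem period_eq_sub_of_contraction (hσ : R.IsGauge U σ) {x₀ : U}
    (C : C(stdSimplex ℝ (Fin 2) × U, U)) (hC₀ : ∀ x, C (stdSimplex.vertex 0, x) = x₀)
    (hC₁ : ∀ x, C (stdSimplex.vertex 1, x) = x) (γ : C(stdSimplex ℝ (Fin 2), U)) :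
    D.period R σ ⟨fun t => (γ t : φ.Mcheck), by fun_prop⟩ =
      D.period R σ ⟨fun s => (C (s, γ (stdSimplex.vertex 1)) : φ.Mcheck), by fun_prop⟩ -
      D.period R σ ⟨fun s => (C (s, γ (stdSimplex.vertex 0)) : φ.Mcheck), by fun_prop⟩ := by
  let Q : C(stdSimplex ℝ (Fin 2) × stdSimplex ℝ (Fin 2), φ.Mcheck) :=
    ⟨fun q => (C (q.1, γ q.2) : φ.Mcheck), by fun_prop⟩
  have hid : ∀ (a : Fin 3 → Fin 2) (i : Fin 3) (t : stdSimplex ℝ (Fin 2)),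
      a ∘ i.succAbove = id → stdSimplex.map (a ∘ i.succAbove) t = t := fun a i t h => by
    rw [h, stdSimplex.map_id_apply]
  have hconst : ∀ (a : Fin 3 → Fin 2) (i : Fin 3) (t : stdSimplex ℝ (Fin 2)) (j : Fin 2),
      (a ∘ i.succAbove = fun _ => j) →
      stdSimplex.map (a ∘ i.succAbove) t = stdSimplex.vertex (S := ℝ) j := fun a i t j h => by
    rw [h, stdSimplex.map_const]
  have hQ : ∀ (a b : Fin 3 → Fin 2) (i : Fin 3) (t : stdSimplex ℝ (Fin 2)),
      face i (Q.comp (triangle a b)) t =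
        (C (stdSimplex.map (a ∘ i.succAbove) t, γ (stdSimplex.map (b ∘ i.succAbove) t)) :
          φ.Mcheck) := fun a b i t => by
    change Q (triangle a b (faceMap 1 i t)) = _
    rw [triangle_faceMap]
    rfl
  have h1 := sum_period_face (D := D) hσ (Q.comp (triangle ![0, 1, 1] ![0, 0, 1]))
    fun _ => Subtype.property _
  have h2 := sum_period_face (D := D) hσ (Q.comp (triangle ![0, 0, 1] ![0, 1, 1]))
    fun _ => Subtype.property _
  have h10 : face 0 (Q.comp (triangle ![0, 1, 1] ![0, 0, 1])) =
      ⟨fun t => (γ t : φ.Mcheck), by fun_prop⟩ := by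
    ext1 t
    rw [hQ, hconst _ _ _ 1 (by decide), hid _ _ _ (by decide), hC₁]
    rfl
  have h12 : face 2 (Q.comp (triangle ![0, 1, 1] ![0, 0, 1])) =
      ⟨fun s => (C (s, γ (stdSimplex.vertex 0)) : φ.Mcheck), by fun_prop⟩ := by
    ext1 t
    rw [hQ, hid _ _ _ (by decide), hconst _ _ _ 0 (by decide)]
    rfl
  have h20 : face 0 (Q.comp (triangle ![0, 0, 1] ![0, 1, 1])) =
      ⟨fun s => (C (s, γ (stdSimplex.vertex 1)) : φ.Mcheck), by fun_prop⟩ := by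
    ext1 t
    rw [hQ, hid _ _ _ (by decide), hconst _ _ _ 1 (by decide)]
    rfl
  have h21 : face 1 (Q.comp (triangle ![0, 0, 1] ![0, 1, 1])) =
      face 1 (Q.comp (triangle ![0, 1, 1] ![0, 0, 1])) := by
    ext1 t
    rw [hQ, hQ, hid _ _ _ (by decide), hid _ _ _ (by decide)]
  have h22 : D.period R σ (face 2 (Q.comp (triangle ![0, 0, 1] ![0, 1, 1]))) = 0 := by
    refine period_const hσ x₀.2 fun t => ?_
    rw [hQ, hconst _ _ _ 0 (by decide), hC₀]
  rw [h10, h12] at h1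
  rw [h20, h21, h22] at h2
  linarith

/-- A gauge has a potential over a contractible set. -/
theorem exists_isPotential (hσ : R.IsGauge U σ) (x₀ : U)
    (C : C(unitInterval × U, U)) (hC₀ : ∀ x, C (0, x) = x₀) (hC₁ : ∀ x, C (1, x) = x) :
    ∃ h, D.IsPotential R U σ h := by
  classical
  let C' : C(stdSimplex ℝ (Fin 2) × U, U) :=
    C.comp ⟨fun q => (stdSimplexHomeomorphUnitInterval q.1, q.2), by fun_prop⟩
  have hC₀' : ∀ x, C' (stdSimplex.vertex 0, x) = x₀ := fun x =>
    (congrArg (fun s => C (s, x)) stdSimplexHomeomorphUnitInterval_zero).trans (hC₀ x)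
  have hC₁' : ∀ x, C' (stdSimplex.vertex 1, x) = x := fun x =>
    (congrArg (fun s => C (s, x)) stdSimplexHomeomorphUnitInterval_one).trans (hC₁ x)
  obtain ⟨k, hk⟩ := exists_turn_eq (z := (R.coord (D.s₀ x₀).1 / σ x₀) ^ p) (by
    rw [norm_pow, hσ.norm_coord_div _ x₀.2, one_pow])
  let track : U → Simplex φ.Mcheck 1 := fun x => ⟨fun s => (C' (s, x) : φ.Mcheck), by fun_prop⟩
  have h0 : (R.coord (D.s₀ x₀).1 / σ x₀) ^ p ≠ 0 := by
    rw [← hk]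
    exact turn_ne_zero k
  refine ⟨fun m => if hm : m ∈ U then D.period R σ (track ⟨m, hm⟩) + k else 0, hσ, ?_, ?_⟩
  · intro m hm
    have h1 := turn_period (D := D) hσ (γ := track ⟨m, hm⟩) fun _ => Subtype.property _
    have e0 : track ⟨m, hm⟩ (stdSimplex.vertex 0) = x₀ := congrArg Subtype.val (hC₀' _)
    have e1 : track ⟨m, hm⟩ (stdSimplex.vertex 1) = m := congrArg Subtype.val (hC₁' ⟨m, hm⟩)
    rw [e0, e1] at h1
    rw [dif_pos hm, turn_add, h1, hk, div_mul_cancel₀ _ h0]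
  · intro γ hγ
    rw [dif_pos (hγ _), dif_pos (hγ _)]
    have h1 := period_eq_sub_of_contraction (D := D) hσ C' hC₀' hC₁'
      ⟨fun t => ⟨γ t, hγ t⟩, by fun_prop⟩
    rw [add_sub_add_right_eq_sub]
    exact h1.symm

/-- Potentials in two gauges differ by a smooth function. -/
theorem IsPotential.contMDiffOn_sub {U' : Set φ.Mcheck} {σ' : φ.Mcheck → ℂ}
    {h h' : φ.Mcheck → ℝ} (hh : D.IsPotential R U σ h) (hh' : D.IsPotential R U' σ' h')
    (hU : IsOpen (U ∩ U')) :
    ContMDiffOn (𝓡 3) 𝓘(ℝ, ℝ) ∞ (fun m => h m - h' m) (U ∩ U') := by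
  have hdiv := (hh'.isGauge.contMDiffOn_div hh.isGauge).mono (Set.inter_comm U U').subset
  have hf : ContMDiffOn (𝓡 3) 𝓘(ℝ, ℂ) ∞ (fun m => (σ' m / σ m) ^ p) (U ∩ U') :=
    (contDiff_id.pow p : ContDiff ℝ ∞ fun z : ℂ => z ^ p).contMDiff.comp_contMDiffOn hdiv
  have hn : ∀ m ∈ U ∩ U', ‖σ' m / σ m‖ = 1 := fun m hm => by
    rw [norm_div, hh.isGauge.norm_eq m hm.1, hh'.isGauge.norm_eq m hm.2, div_one]
  refine contMDiffOn_of_variation hU hf (fun m hm => by rw [norm_pow, hn m hm, one_pow])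
    fun γ hγ => ?_
  have hc : Continuous fun t => σ' (γ t) / σ (γ t) :=
    hdiv.continuousOn.comp_continuous γ.continuous hγ
  have h1 := hh.sub_eq γ fun t => (hγ t).1
  have h2 := hh'.sub_eq γ fun t => (hγ t).2
  have h3 : (variation fun t => R.coord (D.s₁ γ t).1 / σ (γ t)) =
      (variation fun t => R.coord (D.s₁ γ t).1 / σ' (γ t)) +
        variation fun t => σ' (γ t) / σ (γ t) := by
    rw [← variation_mul (f := fun t => R.coord (D.s₁ γ t).1 / σ' (γ t))
      (hh'.isGauge.continuous_coord_div _ γ (D.base_one γ) fun t => (hγ t).2)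
      (fun t => hh'.isGauge.norm_coord_div _ (hγ t).2) hc fun t => hn _ (hγ t)]
    congr 1
    funext t
    rw [div_mul_div_cancel₀ (hh'.isGauge.ne_zero (hγ t).2)]
  rw [variation_pow hc fun t => hn _ (hγ t)]
  simp only [period, h3] at h1 h2
  linarith

end ObstructionPrimitive

end ChartAtInfinity

/-! ### Contractible sets near infinity -/

/-- A set that is star-shaped in a chart is contractible. -/
theorem exists_contraction_of_starConvex {Y : Type u} [TopologicalSpace Y]
    (e : OpenPartialHomeomorph Y E3) {S : Set E3} (hS : S ⊆ e.target) {y₀ : E3} (hy₀ : y₀ ∈ S)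
    (hst : StarConvex ℝ y₀ S) :
    ∃ (x₀ : ↥(e.source ∩ e ⁻¹' S)) (C : C(unitInterval × ↥(e.source ∩ e ⁻¹' S),
      ↥(e.source ∩ e ⁻¹' S))), (∀ x, C (0, x) = x₀) ∧ ∀ x, C (1, x) = x := by
  have hmem : ∀ y ∈ S, e.symm y ∈ e.source ∩ e ⁻¹' S := fun y hy =>
    ⟨e.map_target (hS hy), by rwa [Set.mem_preimage, e.right_inv (hS hy)]⟩
  have hseg : ∀ q : unitInterval × ↥(e.source ∩ e ⁻¹' S),
      (1 - q.1 : ℝ) • y₀ + (q.1 : ℝ) • e q.2 ∈ S := fun q =>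
    hst q.2.2.2 (by linarith [q.1.2.2]) q.1.2.1 (by ring)
  have hce : Continuous fun x : ↥(e.source ∩ e ⁻¹' S) => e x :=
    e.continuousOn.comp_continuous continuous_subtype_val fun x => x.2.1
  refine ⟨⟨e.symm y₀, hmem y₀ hy₀⟩, ⟨fun q =>
    ⟨e.symm ((1 - q.1 : ℝ) • y₀ + (q.1 : ℝ) • e q.2), hmem _ (hseg q)⟩, ?_⟩, ?_, ?_⟩
  · refine Continuous.subtype_mk (e.symm.continuousOn.comp_continuous ?_ fun q => hS (hseg q)) _
    exact ((by fun_prop : Continuous fun q : unitInterval × ↥(e.source ∩ e ⁻¹' S) =>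
      (1 - q.1 : ℝ) • y₀)).add ((by fun_prop : Continuous fun q : unitInterval ×
      ↥(e.source ∩ e ⁻¹' S) => (q.1 : ℝ)).smul (hce.comp continuous_snd))
  · intro x
    ext1
    simp
  · intro x
    ext1
    simpa using e.left_inv x.2.1

/-- The complement of a half-axis of `ℝ³`, the sign of `ε` being opposite to that of the points of
the half-axis. -/
def slit (ε : ℝ) : Set E3 := {y | y 0 ≠ 0 ∨ y 1 ≠ 0 ∨ 0 < ε * y 2}

theorem isOpen_slit (ε : ℝ) : IsOpen (slit ε) := by
  have h0 : IsOpen {y : E3 | y 0 ≠ 0} := isOpen_ne_fun (by fun_prop) continuous_const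
  have h1 : IsOpen {y : E3 | y 1 ≠ 0} := isOpen_ne_fun (by fun_prop) continuous_const
  have h2 : IsOpen {y : E3 | 0 < ε * y 2} := isOpen_lt continuous_const (by fun_prop)
  exact h0.union (h1.union h2)

theorem smul_stdVec_mem_slit {ε : ℝ} (hε : ε ≠ 0) {t : ℝ} (ht : 0 < t) :
    (t * ε) • stdVec 2 ∈ slit ε := by
  right; right
  have : 0 < ε ^ 2 := by positivity
  simp only [stdVec, PiLp.smul_apply, PiLp.single_apply, if_true, smul_eq_mul]
  nlinarith

theorem starConvex_slit {ε : ℝ} (hε : ε ≠ 0) {t : ℝ} (ht : 0 < t) :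
    StarConvex ℝ ((t * ε) • stdVec 2) (slit ε) := by
  intro y hy a b ha hb hab
  have hε2 : 0 < ε ^ 2 := by positivity
  rcases hb.eq_or_lt with rfl | hb
  · obtain rfl : a = 1 := by linarith
    simpa using smul_stdVec_mem_slit hε ht
  · rcases hy with hy | hy | hy
    · left
      simpa [stdVec, hb.ne'] using hy
    · right; left
      simpa [stdVec, hb.ne'] using hy
    · right; right
      have h1 : 0 ≤ a * (t * ε ^ 2) := by positivity
      have h2 : 0 < b * (ε * y 2) := by positivity
      simp only [stdVec, PiLp.add_apply, PiLp.smul_apply, PiLp.single_apply, if_true,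
        smul_eq_mul]
      nlinarith

/-- The complement of an axis in a ball is path connected. -/
theorem joinedIn_ball_slit {r : ℝ} {x y : E3} (hx : x ∈ Metric.ball 0 r) (hy : y ∈ Metric.ball 0 r)
    (hx' : x ∈ slit 1 ∩ slit (-1)) (hy' : y ∈ slit 1 ∩ slit (-1)) :
    JoinedIn (Metric.ball 0 r ∩ (slit 1 ∩ slit (-1))) x y := by
  have hs : ∀ z : E3, z ∈ slit 1 ∩ slit (-1) ↔ z 0 ≠ 0 ∨ z 1 ≠ 0 := fun z => by
    simp only [slit, Set.mem_inter_iff, Set.mem_ofPred_eq, one_mul, neg_mul, Left.neg_pos_iff]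
    constructor
    · rintro ⟨h1 | h1 | h1, h2 | h2 | h2⟩ <;> first | tauto | linarith
    · tauto
  let L : E3 →ₗ[ℝ] ℝ × ℝ :=
    (EuclideanSpace.proj (𝕜 := ℝ) (0 : Fin 3)).toLinearMap.prod
      (EuclideanSpace.proj (𝕜 := ℝ) (1 : Fin 3)).toLinearMap
  have hL : ∀ z, L z = (z 0, z 1) := fun z => rfl
  have hker : ∀ z, z ∈ (L.ker : Set E3)ᶜ ↔ z 0 ≠ 0 ∨ z 1 ≠ 0 := fun z => by
    rw [Set.mem_compl_iff, SetLike.mem_coe, LinearMap.mem_ker, hL, Prod.mk_eq_zero]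
    tauto
  have hsurj : Function.Surjective L := fun q => ⟨!₂[q.1, q.2, 0], by simp [hL]⟩
  have hpc : IsPathConnected ((L.ker : Set E3)ᶜ) := by
    refine isPathConnected_compl_of_one_lt_codim ?_
    rw [(L.quotKerEquivOfSurjective hsurj).rank_eq]
    simp
    norm_num
  rw [hs] at hx' hy'
  obtain ⟨γ, hγ⟩ := hpc.joinedIn x ((hker x).2 hx') y ((hker y).2 hy')
  -- The path is pushed into the ball by a radial retraction.
  set ρ := max ‖x‖ ‖y‖ with hρ
  have hρr : ρ < r := max_lt (mem_ball_zero_iff.1 hx) (mem_ball_zero_iff.1 hy)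
  have hρ0 : 0 < ρ := by
    refine (norm_pos_iff.2 ?_).trans_le (le_max_left ‖x‖ ‖y‖)
    rintro rfl
    simp at hx'
  have hm : ∀ z : E3, 0 < max ‖z‖ ρ := fun z => hρ0.trans_le (le_max_right _ _)
  have hfix : ∀ z : E3, ‖z‖ ≤ ρ → (ρ / max ‖z‖ ρ) • z = z := fun z hz => by
    rw [max_eq_right hz, div_self hρ0.ne', one_smul]
  refine ⟨⟨⟨fun t => (ρ / max ‖γ t‖ ρ) • γ t, ?_⟩, ?_, ?_⟩, fun t => ⟨?_, ?_⟩⟩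
  · exact (continuous_const.div (by fun_prop) fun t => (hm _).ne').smul γ.continuous
  · simpa using hfix x (le_max_left _ _)
  · simpa using hfix y (le_max_right _ _)
  · rw [mem_ball_zero_iff]
    refine lt_of_le_of_lt ?_ hρr
    change ‖(ρ / max ‖γ t‖ ρ) • γ t‖ ≤ ρ
    rw [norm_smul, Real.norm_of_nonneg (div_nonneg hρ0.le (hm _).le), div_mul_eq_mul_div,
      div_le_iff₀ (hm _)]
    gcongr
    exact le_max_left _ _
  · have h0 : ρ / max ‖γ t‖ ρ ≠ 0 := (div_pos hρ0 (hm _)).ne'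
    rw [hs]
    simpa [h0, hρ0.ne', (hm _).ne'] using (hker _).1 (hγ t)

namespace ChartAtInfinity

open SingularCohomology

variable {M : Type u} [TopologicalSpace M] [ChartedSpace E3 M] [IsManifold (𝓡 3) ∞ M] [T2Space M]
  {o : ManifoldOrientation M} {φ : ChartAtInfinity o} {g : φ.RiemMetric}
  {X : ∀ m : φ.Mcheck, TangentSpace (𝓡 3) m}

variable (φ) in
/-- The chart at infinity, restricted to `M ∖ {∞}`. -/
def chartCheck : OpenPartialHomeomorph φ.Mcheck E3 :=
  φ.chart.subtypeRestr (s := φ.Mcheck) ⟨⟨φ.chart.symm (stdVec 0), fun h => by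
    have h1 : stdVec 0 ∈ φ.chart.target := φ.closedBall_subset (by simp [stdVec])
    have h2 := congrArg φ.chart h
    rw [infty, φ.chart.right_inv h1, φ.chart.right_inv zero_mem_target] at h2
    simpa [stdVec] using congrArg norm h2⟩⟩

theorem chartCheck_apply (m : φ.Mcheck) : φ.chartCheck m = φ.chart m := rfl

theorem chartCheck_source : φ.chartCheck.source = φ.sourceCheck :=
  OpenPartialHomeomorph.subtypeRestr_source _ _

theorem mem_chartCheck_target {y : E3} (hy : y ∈ φ.chart.target) (h0 : y ≠ 0) :
    y ∈ φ.chartCheck.target := by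
  have hm : φ.chart.symm y ∈ φ.Mcheck := fun h => h0 (by
    have h2 := congrArg φ.chart h
    rwa [infty, φ.chart.right_inv hy, φ.chart.right_inv zero_mem_target] at h2)
  have h1 : (⟨_, hm⟩ : φ.Mcheck) ∈ φ.chartCheck.source := by
    rw [chartCheck_source]
    exact φ.chart.map_target hy
  have h2 := φ.chartCheck.map_source h1
  rwa [chartCheck_apply, φ.chart.right_inv hy] at h2

theorem isClosed_Vcheck : IsClosed φ.Vcheck :=
  (((isCompact_closedBall (0 : E3) 1).image_of_continuousOn
    (φ.chart.symm.continuousOn.mono φ.closedBall_subset)).isClosed).preimage continuous_subtype_val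


namespace ObstructionPrimitive

variable {p : ℕ} {D : φ.ObstructionPrimitive g X p} {R : φ.RefFrame g X} {U V : Set φ.Mcheck}
  {σ : φ.Mcheck → ℂ} {h h' : φ.Mcheck → ℝ}

theorem IsPotential.mono_congr (hh : D.IsPotential R U σ h) (hV : V ⊆ U)
    (he : ∀ m ∈ V, h' m = h m) : D.IsPotential R V σ h' :=
  ⟨hh.isGauge.mono hV, fun m hm => by rw [he m hm, hh.turn_eq m (hV hm)], fun γ hγ => by
    rw [he _ (hγ _), he _ (hγ _), hh.sub_eq γ fun t => hV (hγ t)]⟩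

theorem IsPotential.add_intCast (hh : D.IsPotential R U σ h) (n : ℤ) :
    D.IsPotential R U σ fun m => h m + n :=
  ⟨hh.isGauge, fun m hm => by rw [turn_add, turn_intCast, mul_one, hh.turn_eq m hm],
    fun γ hγ => by rw [← hh.sub_eq γ hγ]; ring⟩

theorem exists_isPotential_of_starConvex (e : OpenPartialHomeomorph φ.Mcheck E3) {S : Set E3}
    (hS : S ⊆ e.target) {y₀ : E3} (hy₀ : y₀ ∈ S) (hst : StarConvex ℝ y₀ S)
    (hσ : R.IsGauge (e.source ∩ e ⁻¹' S) σ) :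
    ∃ h, D.IsPotential R (e.source ∩ e ⁻¹' S) σ h := by
  obtain ⟨x₀, C, hC₀, hC₁⟩ := exists_contraction_of_starConvex e hS hy₀ hst
  exact exists_isPotential hσ x₀ C hC₀ hC₁

/-- Every point has arbitrarily small neighbourhoods with a gauge and a potential. -/
theorem exists_isPotential_nhds (hXs : IsSmoothField X Set.univ) {O : Set φ.Mcheck} (hO : IsOpen O)
    {m : φ.Mcheck} (hm : m ∈ O) :
    ∃ U ⊆ O, IsOpen U ∧ m ∈ U ∧ ∃ σ h, D.IsPotential R U σ h := by
  obtain ⟨V, hV, hmV, σ, hσ⟩ := RefFrame.exists_isGauge (R := R) hXs m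
  set e := chartAt E3 m
  have hme : m ∈ e.source := mem_chart_source E3 m
  have ho : IsOpen (e.target ∩ e.symm ⁻¹' (O ∩ V)) := e.isOpen_inter_preimage_symm (hO.inter hV)
  obtain ⟨r, hr, hball⟩ := Metric.isOpen_iff.1 ho (e m)
    ⟨e.map_source hme, by rw [Set.mem_preimage, e.left_inv hme]; exact ⟨hm, hmV⟩⟩
  have hsub : e.source ∩ e ⁻¹' Metric.ball (e m) r ⊆ O ∩ V := fun x hx => by
    have := (hball hx.2).2
    rwa [Set.mem_preimage, e.left_inv hx.1] at this
  have hc : e m ∈ Metric.ball (e m) r := Metric.mem_ball_self hr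
  refine ⟨_, fun x hx => (hsub hx).1, e.isOpen_inter_preimage Metric.isOpen_ball, ⟨hme, hc⟩, σ, ?_⟩
  exact exists_isPotential_of_starConvex e (fun y hy => (hball hy).1) hc
    ((convex_ball _ _).starConvex hc) (hσ.mono fun x hx => (hsub hx).2)

/-- A gauge over a punctured ball around infinity has a potential, which is stated locally. The
punctured ball is the union of two slit balls, which are contractible; as their intersection is
connected, the potentials over the two differ by a constant integer there. -/
theorem exists_isPotential_ballCheck {r : ℝ} (hr : 0 < r) (hrt : Metric.ball 0 r ⊆ φ.chart.target)
    (hσ : R.IsGauge (φ.ballCheck r) σ) :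
    ∃ h, ∀ m ∈ φ.ballCheck r, ∃ U, IsOpen U ∧ m ∈ U ∧ D.IsPotential R U σ h := by
  classical
  let S : ℝ → Set E3 := fun ε => Metric.ball 0 r ∩ slit ε
  let U : ℝ → Set φ.Mcheck := fun ε => φ.chartCheck.source ∩ φ.chartCheck ⁻¹' S ε
  have hUball : ∀ ε, U ε ⊆ φ.ballCheck r := fun ε m hm =>
    ⟨chartCheck_source (φ := φ) ▸ hm.1, mem_ball_zero_iff.1 hm.2.1⟩
  have hSt : ∀ ε, S ε ⊆ φ.chartCheck.target := fun ε y hy =>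
    mem_chartCheck_target (hrt hy.1) (by
      rintro rfl
      simpa [slit] using hy.2)
  have hUo : ∀ ε, IsOpen (U ε) := fun ε =>
    φ.chartCheck.isOpen_inter_preimage (Metric.isOpen_ball.inter (isOpen_slit ε))
  have hpot : ∀ ε, |ε| = 1 → ∃ h, D.IsPotential R (U ε) σ h := fun ε hε => by
    have hε0 : ε ≠ 0 := by
      rintro rfl
      simp at hε
    have hb : (r / 2 * ε) • stdVec 2 ∈ Metric.ball (0 : E3) r := by
      rw [mem_ball_zero_iff, norm_smul, Real.norm_eq_abs, abs_mul, hε, abs_of_pos (by positivity)]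
      simp [stdVec, hr]
    exact exists_isPotential_of_starConvex φ.chartCheck (hSt ε)
      ⟨hb, smul_stdVec_mem_slit hε0 (by positivity)⟩
      (((convex_ball _ _).starConvex hb).inter (starConvex_slit hε0 (by positivity)))
      (hσ.mono (hUball ε))
  obtain ⟨h₁, hh₁⟩ := hpot 1 (by simp)
  obtain ⟨h₂, hh₂⟩ := hpot (-1) (by simp)
  have hpath : ∀ m ∈ U 1 ∩ U (-1), ∀ m' ∈ U 1 ∩ U (-1), h₁ m - h₂ m = h₁ m' - h₂ m' := by
    intro m hm m' hm'
    obtain ⟨γ, hγ⟩ := joinedIn_ball_slit hm.1.2.1 hm'.1.2.1 ⟨hm.1.2.2, hm.2.2.2⟩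
      ⟨hm'.1.2.2, hm'.2.2.2⟩
    have hγt : ∀ t, γ t ∈ φ.chartCheck.target := fun t => hSt 1 ⟨(hγ t).1, (hγ t).2.1⟩
    let P : Path m m' :=
      { toFun := fun t => φ.chartCheck.symm (γ t)
        continuous_toFun := φ.chartCheck.symm.continuousOn.comp_continuous γ.continuous hγt
        source' := by rw [γ.source, φ.chartCheck.left_inv hm.1.1]
        target' := by rw [γ.target, φ.chartCheck.left_inv hm'.1.1] }
    have hP : ∀ t, P t ∈ U 1 ∩ U (-1) := fun t => by
      have h1 : φ.chartCheck (P t) = γ t := φ.chartCheck.right_inv (hγt t)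
      have h2 : P t ∈ φ.chartCheck.source := φ.chartCheck.map_target (hγt t)
      refine ⟨⟨h2, ?_⟩, ⟨h2, ?_⟩⟩
      · rw [Set.mem_preimage, h1]
        exact ⟨(hγ t).1, (hγ t).2.1⟩
      · rw [Set.mem_preimage, h1]
        exact ⟨(hγ t).1, (hγ t).2.2⟩
    have e1 := hh₁.sub_eq (pathSimplex P) fun t => (hP _).1
    have e2 := hh₂.sub_eq (pathSimplex P) fun t => (hP _).2
    rw [pathSimplex_vertex_zero, pathSimplex_vertex_one] at e1 e2
    linarith
  obtain ⟨n, hn⟩ : ∃ n : ℤ, ∀ m ∈ U 1 ∩ U (-1), h₁ m = h₂ m + n := by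
    rcases (U 1 ∩ U (-1)).eq_empty_or_nonempty with h0 | ⟨m₀, hm₀⟩
    · exact ⟨0, fun m hm => by simp [h0] at hm⟩
    · obtain ⟨n, hn⟩ := turn_eq_one_iff.1 (show turn (h₁ m₀ - h₂ m₀) = 1 by
        rw [turn_sub, hh₁.turn_eq _ hm₀.1, hh₂.turn_eq _ hm₀.2,
          div_self (by rw [← hh₁.turn_eq _ hm₀.1]; exact turn_ne_zero _)])
      exact ⟨n, fun m hm => by linarith [hpath m hm m₀ hm₀]⟩
  refine ⟨fun m => if m ∈ U 1 then h₁ m else h₂ m + n, fun m hm => ?_⟩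
  have hms : m ∈ φ.chartCheck.source := chartCheck_source (φ := φ) ▸ hm.1
  have hmb : φ.chartCheck m ∈ Metric.ball (0 : E3) r := mem_ball_zero_iff.2 hm.2
  by_cases h : φ.chartCheck m ∈ slit 1
  · exact ⟨U 1, hUo 1, ⟨hms, hmb, h⟩, hh₁.mono_congr subset_rfl fun x hx => if_pos hx⟩
  · refine ⟨U (-1), hUo (-1), ⟨hms, hmb, ?_⟩,
      (hh₂.add_intCast n).mono_congr subset_rfl fun x hx => ?_⟩
    · by_contra h'
      simp only [slit, Set.mem_ofPred_eq, not_or, not_not, not_lt, one_mul, neg_mul,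
        Left.neg_nonpos_iff] at h h'
      refine chart_ne_zero (φ := φ) hm.1 ?_
      have h2 : φ.chartCheck m = 0 := by
        ext i
        fin_cases i
        · exact h.1
        · exact h.2.1
        · exact le_antisymm h.2.2 h'.2.2
      exact h2
    · by_cases hx1 : x ∈ U 1
      · rw [if_pos hx1, hn x ⟨hx1, hx⟩]
      · rw [if_neg hx1]

end ObstructionPrimitive

end ChartAtInfinity

namespace ChartAtInfinity

variable {M : Type u} [TopologicalSpace M] [ChartedSpace E3 M] [IsManifold (𝓡 3) ∞ M] [T2Space M]
  {o : ManifoldOrientation M} {φ : ChartAtInfinity o} {g : φ.RiemMetric}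
  {X : ∀ m : φ.Mcheck, TangentSpace (𝓡 3) m}

/-! ### Existence of multisections -/

theorem sigmaCompactSpace_Mcheck [CompactSpace M] : SigmaCompactSpace φ.Mcheck := by
  have h1 : SecondCountableTopology M := ChartedSpace.secondCountable_of_sigmaCompact E3 M
  have h2 : LocallyCompactSpace φ.Mcheck := ChartedSpace.locallyCompactSpace E3 φ.Mcheck
  infer_instance

theorem _root_.SmoothPartitionOfUnity.finsum_smul_sub {Y ι : Type*} [TopologicalSpace Y]
    [ChartedSpace E3 Y] (ρ : SmoothPartitionOfUnity ι (𝓡 3) Y Set.univ) (h : ι → Y → ℝ) (x : Y)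
    (a : ℝ) : ∑ᶠ i, ρ i x • (h i x - a) = ∑ᶠ i, ρ i x • h i x - a := by
  have hfin : (Function.support fun i => ρ i x).Finite := ρ.locallyFinite.point_finite x
  have h1 : ∑ᶠ i, ρ i x • a = a := by
    rw [← finsum_smul' hfin, ρ.sum_eq_one (Set.mem_univ x), one_smul]
  conv_rhs => rw [← h1]
  have hs : ∀ b : ι → ℝ, (Function.support fun i => ρ i x • b i).Finite := fun b =>
    hfin.subset (Function.support_smul_subset_left (fun i => ρ i x) b)
  rw [← finsum_sub_distrib (hs _) (hs _)]
  exact finsum_congr fun i => smul_sub _ _ _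

namespace ObstructionPrimitive

variable {p : ℕ} {D : φ.ObstructionPrimitive g X p} {R : φ.RefFrame g X}

/-- Local potentials that agree with a given function near infinity are glued by a partition of
unity. -/
theorem exists_glued_potential [CompactSpace M] (h₀ : φ.Mcheck → ℝ)
    (hloc : ∀ m, ∃ U, IsOpen U ∧ m ∈ U ∧ ∃ σ h, D.IsPotential R U σ h ∧
      ∀ x ∈ U ∩ φ.Vcheck, h x = h₀ x) :
    ∃ K : φ.Mcheck → ℝ, (∀ m ∈ φ.Vcheck, K m = h₀ m) ∧
      ∀ m, ∃ U, IsOpen U ∧ m ∈ U ∧ ∃ σ h, D.IsPotential R U σ h ∧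
        ContMDiffOn (𝓡 3) 𝓘(ℝ, ℝ) ∞ (fun x => h x - K x) U := by
  have := sigmaCompactSpace_Mcheck (φ := φ)
  choose U hU hmU σ h hh heq using hloc
  obtain ⟨ρ, hρ⟩ := SmoothPartitionOfUnity.exists_isSubordinate (𝓡 3) isClosed_univ U hU
    fun m _ => Set.mem_iUnion.2 ⟨m, hmU m⟩
  have hρU : ∀ {i x}, ρ i x ≠ 0 → x ∈ U i := fun {i x} hx => hρ i (subset_tsupport _ hx)
  refine ⟨fun x => ∑ᶠ i, ρ i x • h i x, fun x hx => ?_,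
    fun j => ⟨U j, hU j, hmU j, σ j, h j, hh j, fun x hx => ?_⟩⟩
  · rw [← sub_eq_zero, ← ρ.finsum_smul_sub]
    refine finsum_eq_zero_of_forall_eq_zero fun i => ?_
    by_cases hi : ρ i x = 0
    · rw [hi, zero_smul]
    · rw [heq i x ⟨hρU hi, hx⟩, sub_self, smul_zero]
  · have h1 : ContMDiffAt (𝓡 3) 𝓘(ℝ, ℝ) ∞
        (fun y => ∑ᶠ i, ρ i y • (fun z => h i z - h j z) y) x :=
      ρ.contMDiffAt_finsum fun i hi =>
        ((hh i).contMDiffOn_sub (hh j) ((hU i).inter (hU j))).contMDiffAt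
          (((hU i).inter (hU j)).mem_nhds ⟨hρ i hi, hx⟩)
    refine (h1.neg.congr_of_eventuallyEq (Filter.Eventually.of_forall fun y => ?_)).contMDiffWithinAt
    change _ = -∑ᶠ i, ρ i y • (h i y - h j y)
    rw [ρ.finsum_smul_sub, neg_sub]

/-- The rotation of the section of `UX^⊥_p` defined by `s₀` by the opposite of a glued potential is
a multisection. -/
theorem exists_isMultisection [CompactSpace M] (D : φ.ObstructionPrimitive g X p)
    (hg : φ.IsStandardMetric g) (hX : φ.IsCombing g X) (hp : 0 < p) :
    ∃ ν : φ.Mcheck → φ.UPerpMod g X p, φ.IsMultisection g X p ν := by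
  obtain ⟨R⟩ := exists_refFrame (o := o) hX.unit
  have hXs : IsSmoothField X Set.univ := hX.smooth.contMDiffOn
  have hp' : (p : ℝ) ≠ 0 := by exact_mod_cast hp.ne'
  obtain ⟨r, hr, hrt, ς, hς, hςs⟩ := R.exists_standard_gauge hg hX
  obtain ⟨h₀, hh₀⟩ := exists_isPotential_ballCheck (D := D) (by linarith) hrt hς
  obtain ⟨K, hKV, hK⟩ := exists_glued_potential (D := D) (R := R) h₀ fun m => by
    by_cases hm : m ∈ φ.Vcheck
    · obtain ⟨U, hU, hmU, hh⟩ := hh₀ m (Vcheck_subset_ballCheck hr hm)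
      exact ⟨U, hU, hmU, ς, h₀, hh, fun _ _ => rfl⟩
    · obtain ⟨U, hUV, hU, hmU, σ, h, hh⟩ :=
        exists_isPotential_nhds (D := D) (R := R) hXs isClosed_Vcheck.isOpen_compl hm
      exact ⟨U, hU, hmU, σ, h, hh, fun x hx => (hUV hx.1 hx.2).elim⟩
  choose ν hνb hνc using fun m => R.exists_coordMod hp m
    (c := R.coord (D.s₀ m).1 ^ p * turn (-K m))
    (by rw [norm_mul, norm_pow, R.norm_coord, one_pow, norm_turn, one_mul])
  -- The coordinate of `ν` in a gauge that has a potential.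
  have hcoord : ∀ {U : Set φ.Mcheck} {σ : φ.Mcheck → ℂ} {h : φ.Mcheck → ℝ},
      D.IsPotential R U σ h → ∀ m ∈ U, R.coordMod hp (ν m) = turn (h m - K m) * σ m ^ p := by
    intro U σ h hh m hm
    rw [hνc, sub_eq_add_neg, turn_add, hh.turn_eq m hm, div_pow, mul_right_comm,
      div_mul_cancel₀ _ (pow_ne_zero _ (hh.isGauge.ne_zero hm))]
  refine ⟨ν, hνb, RefFrame.isSmooth_of_gauge (R := R) hp fun m => ?_, fun m hm => ?_⟩
  · obtain ⟨U, hU, hmU, σ, h, hh, hs⟩ := hK m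
    refine ⟨U, hU, hmU, U, σ, fun x => x, fun x => turn ((h x - K x) / p), hh.isGauge,
      contMDiffOn_id, fun x hx => hx, ?_, fun x hx => ⟨norm_turn _, hνb x, ?_⟩⟩
    · exact (contDiff_turn.comp (contDiff_id.div_const _)).contMDiff.comp_contMDiffOn hs
    · rw [hcoord hh x hx, mul_pow, ← turn_natCast_mul, mul_div_cancel₀ _ hp']
  · have hmr := Vcheck_subset_ballCheck hr hm
    obtain ⟨U, -, hmU, hh⟩ := hh₀ m hmr
    refine (R.isStandard_iff hp hm (hς.norm_eq m hmr) (hςs m hm)).2 ⟨hνb m, ?_⟩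
    rw [hcoord hh m hmU, hKV m hm, sub_self, turn_zero, one_mul]

end ObstructionPrimitive

end ChartAtInfinity

end

theorem mainTheorem9 {M : Type u} [TopologicalSpace M] [T2Space M] [CompactSpace M]
    [ChartedSpace E3 M] [IsManifold (𝓡 3) ∞ M]
    (hM : HasRationalHomologyOfSphere3 M) (o : ManifoldOrientation M) (φ : ChartAtInfinity o)
    (g : φ.RiemMetric) (hg : φ.IsStandardMetric g)
    (X : ∀ m : φ.Mcheck, TangentSpace (𝓡 3) m) (hX : φ.IsCombing g X)
    (e : SingularCohomology φ.Mcheck 2) (he : φ.IsEulerClass g X e)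
    (p : ℕ) (hp : 0 < p) (hpe : addOrderOf e ∣ p) :
    (∃ ν : φ.Mcheck → φ.UPerpMod g X p, φ.IsMultisection g X p ν) ∧
    ∀ ν ν' : φ.Mcheck → φ.UPerpMod g X p,
      φ.IsMultisection g X p ν → φ.IsMultisection g X p ν' →
      ∃ H : unitInterval × φ.Mcheck → φ.UPerpMod g X p,
        φ.IsHomotopyOfMultisections g X p ν ν' H := by
  obtain ⟨D⟩ := ChartAtInfinity.exists_obstructionPrimitive he hpe
  exact ⟨D.exists_isMultisection hg hX hp, fun ν ν' hν hν' =>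
    ChartAtInfinity.exists_homotopy_of_multisections (hM.other 1 one_ne_zero (by norm_num)) hg hX hp
      hν hν'⟩
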